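/- Let $n,m\in\mathbb N$, let $\Omega\subset\mathbb R^n$ and $U\subset\mathbb R^m$ be compact with $U\neq\emptyset$, and let $T\ge 0$. Call a function locally Lipschitz on a set if it is Lipschitz on every compact subset of that set. Let $c:\mathbb R^n\times\mathbb R^m\times\mathbb R\to\mathbb R$, $g:\mathbb R^n\to\mathbb R$ and $f:\mathbb R^n\times\mathbb R^m\to\mathbb R^n$ be locally Lipschitz on $\Omega\times U\times[0,T]$, on $\Omega$, and on $\mathbb R^n\times U$, respectively. For $\Theta\subseteq\mathbb R^n$, $S\geq 0$ and $(x_0,t_0)\in\mathbb R^n\times[0,S]$, let $\mathcal U_{\Theta,S}(x_0,t_0)$ be the set of measurable $u:[t_0,S]\to U$ for which there is exactly one absolutely continuous $\varphi:[t_0,S]\to\Theta$ with $\varphi(t_0)=x_0$ and $\dot\varphi(t)=f(\varphi(t),u(t))$ for almost every $t\in[t_0,S]$; write $\varphi_u$ for it. A value function is a map $V:\mathbb R^n\times\mathbb R\to[-\infty,\infty]$ such that for all $(x,t)\in\Omega\times[0,T]$ $$V(x,t)=\inf_{u\in\mathcal U_{\Omega,T}(x,t)}\Big\{\int_t^T c(\varphi_u(s),u(s),s)\,ds+g(\varphi_u(T))\Big\},\qquad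 \inf\emptyset=+\infty .$$ Let $\Lambda\subseteq\Omega$ be measurable and satisfy the reachable-set condition $$\{\varphi_u(S): x\in\Lambda,\ S\in[0,T],\ u\in\mathcal U_{\mathbb R^n,S}(x,0)\}\subseteq\Omega,$$ and let $w$ be a nonnegative integrable function on $\Lambda\times[0,T]$. For $d\in\mathbb N$ consider the program: maximize $\int_{\Lambda\times[0,T]}w(x,t)J(x,t)\,dx\,dt$ over the real polynomials $J$ in $(x,t)$ of degree at most $d$ such that $$\nabla_tJ(x,t)+c(x,u,t)+\nabla_xJ(x,t)^{\top}f(x,u)>0\quad\text{for all }x\in\Omega,\ t\in(0,T),\ u\in U,$$ $$J(x,T)<g(x)\quad\text{for all }x\in\Omega .$$ Then for every value function $V$: 1. $V$ is finite on $\Lambda\times[0,T]$, and $w|V-J|$ is integrable on $\Lambda\times[0,T]$ for every polynomial $J$. 2. For every $d\ge1$ the program is feasible and its objective is bounded above on the feasible set. 3. If $J_d$ is a solution (a feasible maximizer) of the degree-$d$ program for all sufficiently large $d$, then $$\lim_{d\to\infty}\int_{\Lambda\times[0,T]}w(x,t)\,|V(x,t)-J_d(x,t)|\,dx\,dt=0.$$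 4. More generally, the same limit holds if $\varepsilon_d\to0$ and, for all sufficiently large $d$, $J_d$ is feasible for the degree-$d$ program and $\int_{\Lambda\times[0,T]}wQ\le\int_{\Lambda\times[0,T]}wJ_d+\varepsilon_d$ for every feasible $Q$ of that program. -/

import Mathlib

open Set Filter Topology MeasureTheory
open scoped NNReal

/-- `F` is locally Lipschitz on `s`: Lipschitz on every compact subset of `s`. -/
def LocLip {α β : Type*} [PseudoEMetricSpace α] [PseudoEMetricSpace β] (F : α → β)
    (s : Set α) : Prop :=
  ∀ X ⊆ s, IsCompact X → ∃ K : ℝ≥0, LipschitzOnWith K F X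

/-- The data `{c, g, f, Ω, U, T}` of a family of optimal control problems: running cost, terminal
cost, vector field, state constraint set, input constraint set, final time. -/
structure OCP (n m : ℕ) where
  c : EuclideanSpace ℝ (Fin n) × EuclideanSpace ℝ (Fin m) × ℝ → ℝ
  g : EuclideanSpace ℝ (Fin n) → ℝ
  f : EuclideanSpace ℝ (Fin n) × EuclideanSpace ℝ (Fin m) → EuclideanSpace ℝ (Fin n)
  Ω : Set (EuclideanSpace ℝ (Fin n))
  U : Set (EuclideanSpace ℝ (Fin m))
  T : ℝ

/-- The class of Lipschitz optimal control problems. -/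
structure OCP.IsLipschitz {n m : ℕ} (P : OCP n m) : Prop where
  locLip_c : LocLip P.c (P.Ω ×ˢ (P.U ×ˢ Icc 0 P.T))
  locLip_g : LocLip P.g P.Ω
  locLip_f : LocLip P.f (P.Ω ×ˢ P.U)
  isCompact_U : IsCompact P.U

/-- `φ` solves `φ' = f (φ, u)`, `φ t₀ = x₀` on `[t₀, T]` in the sense of Carathéodory (it is
absolutely continuous and the equation holds almost everywhere, that is, the integral equation
holds), and stays in `Ω` on `[t₀, T]`. -/
def IsTrajectory {n m : ℕ} (Ω : Set (EuclideanSpace ℝ (Fin n)))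
    (f : EuclideanSpace ℝ (Fin n) × EuclideanSpace ℝ (Fin m) → EuclideanSpace ℝ (Fin n))
    (T : ℝ) (x₀ : EuclideanSpace ℝ (Fin n)) (t₀ : ℝ) (u : ℝ → EuclideanSpace ℝ (Fin m))
    (φ : ℝ → EuclideanSpace ℝ (Fin n)) : Prop :=
  ContinuousOn φ (Icc t₀ T) ∧
  IntegrableOn (fun s => f (φ s, u s)) (Icc t₀ T) ∧
  (∀ t ∈ Icc t₀ T, φ t = x₀ + ∫ s in t₀..t, f (φ s, u s)) ∧
  ∀ t ∈ Icc t₀ T, φ t ∈ Ω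

/-- `u` is an admissible input at `(x₀, t₀)`: a (Lebesgue) measurable signal `[t₀, T] → U` for which
there is one and only one trajectory from `(x₀, t₀)` that stays in `Ω`. -/
def IsAdmissible {n m : ℕ} (Ω : Set (EuclideanSpace ℝ (Fin n)))
    (U : Set (EuclideanSpace ℝ (Fin m)))
    (f : EuclideanSpace ℝ (Fin n) × EuclideanSpace ℝ (Fin m) → EuclideanSpace ℝ (Fin n))
    (T : ℝ) (x₀ : EuclideanSpace ℝ (Fin n)) (t₀ : ℝ) (u : ℝ → EuclideanSpace ℝ (Fin m)) : Prop :=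
  AEMeasurable u (volume.restrict (Icc t₀ T)) ∧
  (∀ t ∈ Icc t₀ T, u t ∈ U) ∧
  ∃ φ, IsTrajectory Ω f T x₀ t₀ u φ ∧
    ∀ ψ, IsTrajectory Ω f T x₀ t₀ u ψ → EqOn ψ φ (Icc t₀ T)

/-- The set of costs of the admissible inputs at `(x, t)`. -/
def OCP.costs {n m : ℕ} (P : OCP n m) (x : EuclideanSpace ℝ (Fin n)) (t : ℝ) : Set ℝ :=
  {r | ∃ u φ, IsAdmissible P.Ω P.U P.f P.T x t u ∧ IsTrajectory P.Ω P.f P.T x t u φ ∧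
    r = (∫ s in t..P.T, P.c (φ s, u s, s)) + P.g (φ P.T)}

/-- `V` is a value function of the family of problems: on `Ω × [0, T]` it is the infimum of the
costs of the admissible inputs, and `+∞` where there is no admissible input. -/
def OCP.IsValueFunction {n m : ℕ} (P : OCP n m)
    (V : EuclideanSpace ℝ (Fin n) × ℝ → EReal) : Prop :=
  ∀ x ∈ P.Ω, ∀ t ∈ Icc 0 P.T, V (x, t) = ⨅ r ∈ P.costs x t, (r : EReal)

/-- The forward reachable set of `X₀` at the times in `S`, under the state constraint `Ω`. -/
def forwardReachable {n m : ℕ}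
    (f : EuclideanSpace ℝ (Fin n) × EuclideanSpace ℝ (Fin m) → EuclideanSpace ℝ (Fin n))
    (X₀ Ω : Set (EuclideanSpace ℝ (Fin n))) (U : Set (EuclideanSpace ℝ (Fin m)))
    (S : Set ℝ) : Set (EuclideanSpace ℝ (Fin n)) :=
  {y | ∃ x ∈ X₀, ∃ T ∈ S, ∃ u φ, IsAdmissible Ω U f T x 0 u ∧ IsTrajectory Ω f T x 0 u φ ∧
    φ T = y}

/-- The value at `(x, t)` of a polynomial in the coordinates of `x` (the variables `some i`)
and in time `t` (the variable `none`). -/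
noncomputable def polyEval {n : ℕ} (J : MvPolynomial (Option (Fin n)) ℝ)
    (z : EuclideanSpace ℝ (Fin n) × ℝ) : ℝ :=
  MvPolynomial.eval (fun o : Option (Fin n) => o.elim z.2 (fun i => z.1 i)) J

/-- `J` is feasible for the degree-`d` program: it has degree at most `d` and satisfies the strict
dissipation inequalities `∇ₜJ + c + ∇ₓJ ⬝ f > 0` on `Ω × U × (0, T)` and `J(·, T) < g` on `Ω`. -/
def OCP.IsFeasible {n m : ℕ} (P : OCP n m) (d : ℕ)
    (J : MvPolynomial (Option (Fin n)) ℝ) : Prop :=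
  J.totalDegree ≤ d ∧
  (∀ x ∈ P.Ω, ∀ t ∈ Ioo 0 P.T, ∀ u ∈ P.U,
    0 < polyEval (MvPolynomial.pderiv none J) (x, t) + P.c (x, u, t)
      + ∑ i, polyEval (MvPolynomial.pderiv (some i) J) (x, t) * P.f (x, u) i) ∧
  ∀ x ∈ P.Ω, polyEval J (x, P.T) < P.g x

/-- The objective `∫_{Λ × [0, T]} w J` of the degree-`d` program. -/
noncomputable def OCP.objective {n m : ℕ} (P : OCP n m) (Λ : Set (EuclideanSpace ℝ (Fin n)))
    (w : EuclideanSpace ℝ (Fin n) × ℝ → ℝ) (J : MvPolynomial (Option (Fin n)) ℝ) : ℝ :=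
  ∫ z in Λ ×ˢ Icc 0 P.T, w z * polyEval J z

/-- `J` is a solution of the degree-`d` program: a feasible point that maximizes the objective. -/
def OCP.IsSolution {n m : ℕ} (P : OCP n m) (Λ : Set (EuclideanSpace ℝ (Fin n)))
    (w : EuclideanSpace ℝ (Fin n) × ℝ → ℝ) (d : ℕ)
    (J : MvPolynomial (Option (Fin n)) ℝ) : Prop :=
  P.IsFeasible d J ∧ ∀ Q, P.IsFeasible d Q → P.objective Λ w Q ≤ P.objective Λ w J

/-- `J` is a solution of the degree-`d` program up to the tolerance `ε`. -/
def OCP.IsApproxSolution {n m : ℕ} (P : OCP n m) (Λ : Set (EuclideanSpace ℝ (Fin n)))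
    (w : EuclideanSpace ℝ (Fin n) × ℝ → ℝ) (d : ℕ) (ε : ℝ)
    (J : MvPolynomial (Option (Fin n)) ℝ) : Prop :=
  P.IsFeasible d J ∧ ∀ Q, P.IsFeasible d Q → P.objective Λ w Q ≤ P.objective Λ w J + ε

/-! Integrating the dissipation inequality along a trajectory in `Ω` shows that a feasible `J` lies
below every admissible cost, hence below `V` (`OCP.IsFeasible.polyEval_le_cost`). So `∫ w|V - J| = ∫
wV - ∫ wJ` for feasible `J`: maximizing the objective is minimizing the weighted distance. It
remains to find feasible polynomials uniformly close to `V` on `Λ × [0, T]`; each one is a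
competitor for all large `d`.

On `Ω` the function `V` can be infinite or irregular, so a Lipschitz function `W` takes its place.
Extend `f`, `c`, `g` to bounded, globally Lipschitz data and drop the state constraint. The
resulting value function is Lipschitz by Grönwall, and dynamic programming makes it a subsolution of
the Hamilton–Jacobi–Bellman equation in difference form, `W(z + h(f, 1)) - W(z) ≥ -hc - Ch²`.
Convolving `W`, cut off far away, with a polynomial kernel peaked at the origin gives a polynomial
uniformly close to `W`. The convolution averages translates of the difference inequality, so that
inequality survives with a small error, and a small affine correction in time makes it strict
(`OCP.IsExtension.exists_isFeasible_ge`).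

Finally `V = W` on `Λ × [0, T]` (`OCP.IsExtension.value_eq`). The reachable-set condition keeps
every unconstrained trajectory from `Λ` inside `Ω`, so its cost is admissible and `V ≤ W`; the field
is autonomous, so starting times other than 0 are covered too. Conversely, feasible polynomials lie
below `V` and come within any `ε` of `W`, so `W ≤ V`. -/

set_option linter.unusedSectionVars false

/-! ### Bounded Lipschitz extensions of the data. -/

/-- `F` is globally bounded by `K` and globally `K`-Lipschitz. -/
structure BddLip {α β : Type*} [SeminormedAddCommGroup α] [SeminormedAddCommGroup β] (K : ℝ)
    (F : α → β) : Prop where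
  bound : ∀ p, ‖F p‖ ≤ K
  lip : ∀ p q, ‖F p - F q‖ ≤ K * ‖p - q‖

namespace BddLip

variable {α β : Type*} [SeminormedAddCommGroup α] [SeminormedAddCommGroup β] {K K' : ℝ} {F : α → β}

theorem nonneg (h : BddLip K F) : 0 ≤ K := (norm_nonneg _).trans (h.bound 0)

theorem mono (h : BddLip K F) (hK : K ≤ K') : BddLip K' F :=
  ⟨fun p => (h.bound p).trans hK, fun p q => (h.lip p q).trans (by gcongr)⟩

theorem lipschitzWith (h : BddLip K F) : LipschitzWith K.toNNReal F :=
  LipschitzWith.of_dist_le_mul fun p q => by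
    rw [dist_eq_norm, dist_eq_norm, Real.coe_toNNReal _ h.nonneg]
    exact h.lip p q

theorem continuous (h : BddLip K F) : Continuous F := h.lipschitzWith.continuous

end BddLip

/-- A real Lipschitz extension, truncated at a bound for `F` on the compact set, keeps its Lipschitz
constant and its values there. -/
theorem LipschitzOnWith.exists_bddLip_extension {α : Type*} [SeminormedAddCommGroup α]
    {F : α → ℝ} {s : Set α} {C : ℝ≥0} (hs : IsCompact s) (hF : LipschitzOnWith C F s) :
    ∃ K, ∃ G : α → ℝ, BddLip K G ∧ EqOn G F s := by
  obtain ⟨M, hM⟩ := hs.exists_bound_of_continuousOn hF.continuousOn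
  obtain ⟨G, hG, hGF⟩ := hF.extend_real
  refine ⟨max |M| C, fun p => max (-|M|) (min |M| (G p)), ⟨fun p => ?_, fun p q => ?_⟩,
    fun p hp => ?_⟩
  · refine le_trans ?_ (le_max_left _ _)
    rw [Real.norm_eq_abs, abs_le]
    exact ⟨le_max_left _ _, max_le (by linarith [abs_nonneg M]) (min_le_left _ _)⟩
  · calc ‖max (-|M|) (min |M| (G p)) - max (-|M|) (min |M| (G q))‖ ≤ C * ‖p - q‖ := by
          have := ((hG.const_min |M|).const_max (-|M|)).dist_le_mul p q
          rwa [dist_eq_norm, dist_eq_norm] at this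
      _ ≤ max |M| C * ‖p - q‖ := by gcongr; exact le_max_right _ _
  · have h := (hM p hp).trans (le_abs_self M)
    rw [Real.norm_eq_abs, abs_le, hGF hp] at h
    simp only
    rw [min_eq_right h.2, max_eq_right h.1, hGF hp]

theorem EuclideanSpace.norm_le_sum {n : ℕ} (x : EuclideanSpace ℝ (Fin n)) :
    ‖x‖ ≤ ∑ i, ‖x i‖ := by
  conv_lhs => rw [← (EuclideanSpace.basisFun (Fin n) ℝ).sum_repr x]
  refine (norm_sum_le _ _).trans (Finset.sum_le_sum fun i _ => ?_)
  rw [norm_smul]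
  simp

theorem LipschitzOnWith.exists_bddLip_extension_euclidean {α : Type*} [SeminormedAddCommGroup α]
    {n : ℕ} {F : α → EuclideanSpace ℝ (Fin n)} {s : Set α} {C : ℝ≥0} (hs : IsCompact s)
    (hF : LipschitzOnWith C F s) :
    ∃ K, ∃ G : α → EuclideanSpace ℝ (Fin n), BddLip K G ∧ EqOn G F s := by
  have h : ∀ i, ∃ K, ∃ G : α → ℝ, BddLip K G ∧ EqOn G (fun p => F p i) s := fun i =>
    LipschitzOnWith.exists_bddLip_extension hs (C := C) <|
      LipschitzOnWith.of_dist_le_mul fun p hp q hq => by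
        refine le_trans ?_ (hF.dist_le_mul p hp q hq)
        rw [dist_eq_norm, dist_eq_norm]
        exact PiLp.norm_apply_le (F p - F q) i
  choose K G hG hGF using h
  refine ⟨∑ i, K i, fun p => WithLp.toLp 2 fun i => G i p, ⟨fun p => ?_, fun p q => ?_⟩,
    fun p hp => ?_⟩
  · exact (EuclideanSpace.norm_le_sum _).trans (Finset.sum_le_sum fun i _ => (hG i).bound p)
  · refine (EuclideanSpace.norm_le_sum _).trans ?_
    rw [Finset.sum_mul]
    exact Finset.sum_le_sum fun i _ => (hG i).lip p q
  · ext i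
    exact hGF i hp

/-! ### Grönwall's inequality and integral equations. -/

/-- The integral form of Grönwall's inequality. -/
theorem le_mul_exp_of_le_add_integral {δ : ℝ → ℝ} {A K a b : ℝ} (hK : 0 ≤ K)
    (hδ : ContinuousOn δ (Icc a b)) (h : ∀ t ∈ Icc a b, δ t ≤ A + K * ∫ s in a..t, δ s) :
    ∀ t ∈ Icc a b, δ t ≤ A * Real.exp (K * (t - a)) := by
  intro t ht
  have hab : a ≤ b := ht.1.trans ht.2
  set δ' : ℝ → ℝ := IccExtend hab ((Icc a b).domRestrict δ)
  have hδ' : Continuous δ' := (continuousOn_iff_continuous_domRestrict.1 hδ).Icc_extend'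
  have heq : ∀ s ∈ Icc a b, δ' s = δ s := fun s hs => IccExtend_of_mem hab _ hs
  have hint : ∀ s ∈ Icc a b, ∫ r in a..s, δ' r = ∫ r in a..s, δ r := fun s hs =>
    intervalIntegral.integral_congr fun r hr => by
      rw [uIcc_of_le hs.1] at hr
      exact heq r ⟨hr.1, hr.2.trans hs.2⟩
  have hderiv : ∀ s, HasDerivAt (fun s => A + K * ∫ r in a..s, δ' r) (K * δ' s) s := fun s =>
    ((intervalIntegral.integral_hasDerivAt_right (hδ'.intervalIntegrable _ _)
      hδ'.aestronglyMeasurable.stronglyMeasurableAtFilter hδ'.continuousAt).const_mul K).const_add A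
  -- The differential form is applied to the right-hand side of `h`, which is differentiable
  -- although `δ` is only continuous.
  have key := le_gronwallBound_of_liminf_deriv_right_le (f := fun s => A + K * ∫ r in a..s, δ' r)
    (f' := fun s => K * δ' s) (δ := A) (K := K) (ε := 0) (a := a) (b := b)
    (fun s _ => (hderiv s).continuousAt.continuousWithinAt)
    (fun s _ r hr => (hderiv s).hasDerivWithinAt.liminf_right_slope_le hr) (by simp)
    (fun s hs => by
      have hs' := Ico_subset_Icc_self hs
      have := h s hs'
      rw [add_zero, heq s hs', hint s hs']
      gcongr) t ht
  rw [gronwallBound_ε0] at key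
  refine le_trans ?_ key
  simpa only [hint t ht] using h t ht

section ODE

variable {E : Type*} [NormedAddCommGroup E] [NormedSpace ℝ E]

/-- Two solutions of integral equations whose right-hand sides differ by at most `K` times the
distance of the solutions stay exponentially close. -/
theorem norm_sub_le_of_integral_eq {φ ψ F G : ℝ → E} {x y : E} {K a b : ℝ} (hK : 0 ≤ K)
    (hφ : ContinuousOn φ (Icc a b)) (hψ : ContinuousOn ψ (Icc a b))
    (hF : IntegrableOn F (Icc a b)) (hG : IntegrableOn G (Icc a b))
    (hφF : ∀ t ∈ Icc a b, φ t = x + ∫ s in a..t, F s)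
    (hψG : ∀ t ∈ Icc a b, ψ t = y + ∫ s in a..t, G s)
    (hFG : ∀ s ∈ Icc a b, ‖F s - G s‖ ≤ K * ‖φ s - ψ s‖) :
    ∀ t ∈ Icc a b, ‖φ t - ψ t‖ ≤ ‖x - y‖ * Real.exp (K * (t - a)) := by
  refine le_mul_exp_of_le_add_integral hK (hφ.sub hψ).norm fun t ht => ?_
  have hsub : Icc a t ⊆ Icc a b := Icc_subset_Icc_right ht.2
  have hFi : IntervalIntegrable F volume a t :=
    (intervalIntegrable_iff_integrableOn_Icc_of_le ht.1).2 (hF.mono_set hsub)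
  have hGi : IntervalIntegrable G volume a t :=
    (intervalIntegrable_iff_integrableOn_Icc_of_le ht.1).2 (hG.mono_set hsub)
  have hi : IntervalIntegrable (fun s => ‖φ s - ψ s‖) volume a t :=
    ContinuousOn.intervalIntegrable_of_Icc ht.1 ((hφ.sub hψ).norm.mono hsub)
  calc ‖φ t - ψ t‖ = ‖(x - y) + ∫ s in a..t, (F s - G s)‖ := by
        rw [hφF t ht, hψG t ht, intervalIntegral.integral_sub hFi hGi]
        congr 1
        abel
    _ ≤ ‖x - y‖ + ‖∫ s in a..t, (F s - G s)‖ := norm_add_le _ _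
    _ ≤ ‖x - y‖ + K * ∫ s in a..t, ‖φ s - ψ s‖ := by
        gcongr
        rw [← intervalIntegral.integral_const_mul]
        refine (intervalIntegral.norm_integral_le_integral_norm ht.1).trans ?_
        refine intervalIntegral.integral_mono_on ht.1 (hFi.sub hGi).norm (hi.const_mul K) ?_
        exact fun s hs => hFG s (hsub hs)

/-- Global existence for the integral equation of a bounded Lipschitz time-dependent vector
field that is merely measurable in time. -/
theorem exists_integral_solution [CompleteSpace E] {G : ℝ → E → E} {K L : ℝ} (hK : 0 < K)
    (hL : 0 ≤ L) (hb : ∀ s x, ‖G s x‖ ≤ K) (hlip : ∀ s x y, ‖G s x - G s y‖ ≤ K * ‖x - y‖)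
    (hm : ∀ φ : ℝ → E, Continuous φ → AEStronglyMeasurable (fun s => G s (φ s))) (x : E) :
    ∃ φ : ℝ → E, Continuous φ ∧ ∀ t ∈ Icc 0 L, φ t = x + ∫ s in 0..t, G s (φ s) := by
  have hint : ∀ (φ : ℝ → E), Continuous φ → ∀ a b,
      IntervalIntegrable (fun s => G s (φ s)) volume a b := fun φ hφ a b => by
    rw [intervalIntegrable_iff]
    exact Measure.integrableOn_of_bounded (M := K) (by simp) (hm φ hφ)
      (ae_of_all _ fun s => hb _ _)
  -- Bielecki's weight: the unknown is `exp(-2Ks) φ(s)`, for which the Picard map contracts by `1/2`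
  -- on the whole interval, whatever its length.
  let lift : C(Icc 0 L, E) → ℝ → E := fun ψ s => Real.exp (2 * K * s) • IccExtend hL ψ s
  have hlift : ∀ ψ, Continuous (lift ψ) := fun ψ =>
    (by fun_prop : Continuous fun s : ℝ => Real.exp (2 * K * s)).smul ψ.continuous.Icc_extend'
  have hcont : ∀ ψ, Continuous fun t : ℝ => ∫ s in 0..t, G s (lift ψ s) := fun ψ =>
    intervalIntegral.continuous_primitive (hint _ (hlift ψ)) 0
  let P : C(Icc 0 L, E) → C(Icc 0 L, E) := fun ψ =>
    ⟨fun t => Real.exp (-(2 * K * t)) • (x + ∫ s in 0..(t : ℝ), G s (lift ψ s)),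
      (by fun_prop : Continuous fun t : Icc 0 L => Real.exp (-(2 * K * (t : ℝ)))).smul
        (continuous_const.add ((hcont ψ).comp continuous_subtype_val))⟩
  have hP : ContractingWith (1 / 2) P := by
    refine ⟨by norm_num, LipschitzWith.of_dist_le_mul fun ψ χ => ?_⟩
    rw [ContinuousMap.dist_le (by positivity)]
    intro t
    have ht0 : (0 : ℝ) ≤ t := t.2.1
    have hbd : ∀ s ∈ Icc (0 : ℝ) t, ‖G s (lift ψ s) - G s (lift χ s)‖
        ≤ dist ψ χ * (K * Real.exp (2 * K * s)) := fun s _ => by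
      refine (hlip _ _ _).trans ?_
      have h1 : ‖IccExtend hL ψ s - IccExtend hL χ s‖ ≤ dist ψ χ := by
        rw [← dist_eq_norm]
        exact ContinuousMap.dist_apply_le_dist _
      simp only [lift]
      rw [← smul_sub, norm_smul, Real.norm_of_nonneg (Real.exp_pos _).le]
      calc K * (Real.exp (2 * K * s) * ‖IccExtend hL ψ s - IccExtend hL χ s‖)
          ≤ K * (Real.exp (2 * K * s) * dist ψ χ) := by gcongr
        _ = _ := by ring
    have hexp : ∫ s in (0 : ℝ)..t, K * Real.exp (2 * K * s)
        = (Real.exp (2 * K * t) - 1) / 2 := by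
      rw [intervalIntegral.integral_eq_sub_of_hasDerivAt (f := fun s => Real.exp (2 * K * s) / 2)]
      · simp; ring
      · intro s _
        have := ((((hasDerivAt_id s).const_mul (2 * K)).exp).div_const 2)
        convert! this using 1
        simp; ring
      · exact Continuous.intervalIntegrable (by fun_prop) _ _
    have hmain : ‖∫ s in (0 : ℝ)..t, (G s (lift ψ s) - G s (lift χ s))‖
        ≤ dist ψ χ * ((Real.exp (2 * K * t) - 1) / 2) := by
      rw [← hexp, ← intervalIntegral.integral_const_mul]
      refine (intervalIntegral.norm_integral_le_integral_norm ht0).trans ?_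
      exact intervalIntegral.integral_mono_on ht0
        ((hint _ (hlift ψ) _ _).sub (hint _ (hlift χ) _ _)).norm
        (Continuous.intervalIntegrable (by fun_prop) _ _) hbd
    calc dist (P ψ t) (P χ t)
        = Real.exp (-(2 * K * t)) * ‖∫ s in (0 : ℝ)..t, (G s (lift ψ s) - G s (lift χ s))‖ := by
          rw [intervalIntegral.integral_sub (hint _ (hlift ψ) _ _) (hint _ (hlift χ) _ _),
            dist_eq_norm]
          simp only [P, ContinuousMap.coe_mk]
          rw [← smul_sub, norm_smul, Real.norm_of_nonneg (Real.exp_pos _).le, add_sub_add_left_eq_sub]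
      _ ≤ Real.exp (-(2 * K * t)) * (dist ψ χ * ((Real.exp (2 * K * t) - 1) / 2)) := by gcongr
      _ = dist ψ χ * ((1 - Real.exp (-(2 * K * t))) / 2) := by
          have : Real.exp (-(2 * K * t)) * Real.exp (2 * K * t) = 1 := by
            rw [← Real.exp_add]; simp
          linear_combination (dist ψ χ / 2) * this
      _ ≤ dist ψ χ * (1 / 2) := by
          gcongr
          linarith [Real.exp_pos (-(2 * K * (t : ℝ)))]
      _ = _ := by push_cast; ring
  have : Nonempty C(Icc 0 L, E) := ⟨ContinuousMap.const _ 0⟩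
  let ψ := hP.fixedPoint P
  have hfix : P ψ = ψ := hP.fixedPoint_isFixedPt
  refine ⟨lift ψ, hlift ψ, fun t ht => ?_⟩
  have h1 : ψ ⟨t, ht⟩ = Real.exp (-(2 * K * t)) • (x + ∫ s in 0..t, G s (lift ψ s)) := by
    conv_lhs => rw [← hfix]
    rfl
  have h2 : lift ψ t = Real.exp (2 * K * t) • ψ ⟨t, ht⟩ := by
    simp only [lift]
    rw [IccExtend_of_mem hL _ ht]
  rw [h2, h1, smul_smul, ← Real.exp_add]
  simp

end ODE

/-! ### The value function without state constraint. -/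

section ValueFunction

variable {E F : Type*} [NormedAddCommGroup E] [NormedSpace ℝ E] [NormedAddCommGroup F]

/-- `φ` solves `φ' = f (φ, u)` on `[0, L]` from `x`, with a measurable input `u` valued in `U`. -/
structure IsControlled [MeasurableSpace F] (f : E × F → E) (U : Set F) (L : ℝ) (x : E) (u : ℝ → F)
    (φ : ℝ → E) : Prop where
  measurable : Measurable u
  mem : ∀ s, u s ∈ U
  continuous : Continuous φ
  eq_integral : ∀ t ∈ Icc 0 L, φ t = x + ∫ s in 0..t, f (φ s, u s)

/-- The cost from time `t` to `T` of an input and a trajectory whose clock starts at `t`. -/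
noncomputable def controlCost (c : E × F × ℝ → ℝ) (g : E → ℝ) (T t : ℝ) (u : ℝ → F) (φ : ℝ → E) :
    ℝ :=
  (∫ s in 0..(T - t), c (φ s, u s, t + s)) + g (φ (T - t))

/-- The value function of the problem without state constraint. -/
noncomputable def freeValue [MeasurableSpace F] (f : E × F → E) (c : E × F × ℝ → ℝ) (g : E → ℝ)
    (U : Set F) (T L : ℝ) (x : E) (t : ℝ) : ℝ :=
  sInf {r | ∃ u φ, IsControlled f U L x u φ ∧ r = controlCost c g T t u φ}

variable [MeasurableSpace E] [BorelSpace E] [SecondCountableTopology E]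
  [MeasurableSpace F] [BorelSpace F] [SecondCountableTopology F]
  {f : E × F → E} {c : E × F × ℝ → ℝ} {g : E → ℝ} {U : Set F} {K L T : ℝ}

theorem BddLip.intervalIntegrable_field (hf : BddLip K f) {u : ℝ → F} {φ : ℝ → E}
    (hu : Measurable u) (hφ : Continuous φ) (a b : ℝ) :
    IntervalIntegrable (fun s => f (φ s, u s)) volume a b := by
  rw [intervalIntegrable_iff]
  refine Measure.integrableOn_of_bounded (M := K) (by simp) ?_ (ae_of_all _ fun s => hf.bound _)
  exact (hf.continuous.measurable.comp (hφ.measurable.prodMk hu)).aestronglyMeasurable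

theorem BddLip.intervalIntegrable_cost (hc : BddLip K c) {u : ℝ → F} {φ : ℝ → E}
    (hu : Measurable u) (hφ : Continuous φ) (t a b : ℝ) :
    IntervalIntegrable (fun s => c (φ s, u s, t + s)) volume a b := by
  rw [intervalIntegrable_iff]
  refine Measure.integrableOn_of_bounded (M := K) (by simp) ?_ (ae_of_all _ fun s => hc.bound _)
  exact (hc.continuous.measurable.comp (hφ.measurable.prodMk
    (hu.prodMk (measurable_const.add measurable_id)))).aestronglyMeasurable

theorem exists_isControlled [CompleteSpace E] (hf : BddLip K f) (hL : 0 ≤ L) {u : ℝ → F}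
    (hu : Measurable u) (huU : ∀ s, u s ∈ U) (x : E) : ∃ φ, IsControlled f U L x u φ := by
  have hf' : BddLip (K + 1) f := hf.mono (by linarith)
  obtain ⟨φ, hφ, h⟩ := exists_integral_solution (G := fun s x => f (x, u s)) (K := K + 1)
    (by linarith [hf.nonneg]) hL (fun s x => hf'.bound _)
    (fun s x y => (hf'.lip _ _).trans (by simp [Prod.norm_def]))
    (fun φ hφ => (hf.continuous.measurable.comp (hφ.measurable.prodMk hu)).aestronglyMeasurable) x
  exact ⟨φ, hu, huU, hφ, h⟩

namespace IsControlled

variable {x y : E} {u : ℝ → F} {φ ψ : ℝ → E}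

theorem mono (h : IsControlled f U L x u φ) {L' : ℝ} (hL : L' ≤ L) : IsControlled f U L' x u φ :=
  ⟨h.measurable, h.mem, h.continuous, fun t ht => h.eq_integral t ⟨ht.1, ht.2.trans hL⟩⟩

theorem sub_eq_integral (h : IsControlled f U L x u φ) (hf : BddLip K f) {s t : ℝ}
    (hs : s ∈ Icc 0 L) (ht : t ∈ Icc 0 L) : φ t - φ s = ∫ r in s..t, f (φ r, u r) := by
  rw [h.eq_integral t ht, h.eq_integral s hs, add_sub_add_left_eq_sub]
  exact intervalIntegral.integral_interval_sub_left
    (hf.intervalIntegrable_field h.measurable h.continuous _ _)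
    (hf.intervalIntegrable_field h.measurable h.continuous _ _)

theorem norm_sub_le (h : IsControlled f U L x u φ) (hf : BddLip K f) {s t : ℝ}
    (hs : s ∈ Icc 0 L) (ht : t ∈ Icc 0 L) : ‖φ t - φ s‖ ≤ K * |t - s| := by
  rw [h.sub_eq_integral hf hs ht]
  exact intervalIntegral.norm_integral_le_of_norm_le_const fun r _ => hf.bound _

theorem apply_zero (h : IsControlled f U L x u φ) (hL : 0 ≤ L) : φ 0 = x := by
  simpa using h.eq_integral 0 ⟨le_rfl, hL⟩

theorem norm_sub_le_exp (hφ : IsControlled f U L x u φ) (hψ : IsControlled f U L y u ψ)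
    (hf : BddLip K f) {t : ℝ} (ht : t ∈ Icc 0 L) :
    ‖φ t - ψ t‖ ≤ ‖x - y‖ * Real.exp (K * L) := by
  have hL : 0 ≤ L := ht.1.trans ht.2
  have hK := hf.nonneg
  have := norm_sub_le_of_integral_eq (K := K) hK hφ.continuous.continuousOn
    hψ.continuous.continuousOn
    ((intervalIntegrable_iff_integrableOn_Icc_of_le hL).1
      (hf.intervalIntegrable_field hφ.measurable hφ.continuous 0 L))
    ((intervalIntegrable_iff_integrableOn_Icc_of_le hL).1
      (hf.intervalIntegrable_field hψ.measurable hψ.continuous 0 L))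
    hφ.eq_integral hψ.eq_integral
    (fun s _ => (hf.lip _ _).trans (by simp [Prod.norm_def])) t ht
  refine this.trans ?_
  gcongr
  linarith [ht.2]

end IsControlled

theorem controlCost_sub_le (hc : BddLip K c) (hg : BddLip K g) {t η : ℝ} {u : ℝ → F}
    {φ ψ : ℝ → E} (hu : Measurable u) (hφ : Continuous φ) (hψ : Continuous ψ) (ht : t ≤ T)
    (h : ∀ s ∈ Icc 0 (T - t), ‖φ s - ψ s‖ ≤ η) :
    controlCost c g T t u φ ≤ controlCost c g T t u ψ + K * η * (T - t + 1) := by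
  have ht' : 0 ≤ T - t := sub_nonneg.2 ht
  have hK := hc.nonneg
  have h1 : ‖∫ s in 0..(T - t), (c (φ s, u s, t + s) - c (ψ s, u s, t + s))‖
      ≤ K * η * |T - t - 0| :=
    intervalIntegral.norm_integral_le_of_norm_le_const fun s hs => by
      rw [uIoc_of_le ht'] at hs
      refine (hc.lip _ _).trans ?_
      have := h s ⟨hs.1.le, hs.2⟩
      gcongr
      simpa [Prod.norm_def] using this
  rw [intervalIntegral.integral_sub (hc.intervalIntegrable_cost hu hφ _ _ _)
    (hc.intervalIntegrable_cost hu hψ _ _ _), sub_zero, abs_of_nonneg ht', Real.norm_eq_abs] at h1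
  have h2 : |g (φ (T - t)) - g (ψ (T - t))| ≤ K * η := by
    refine (hg.lip _ _).trans ?_
    have := h (T - t) ⟨ht', le_rfl⟩
    gcongr
  unfold controlCost
  linarith [le_of_abs_le h1, le_of_abs_le h2]

theorem neg_le_controlCost (hc : BddLip K c) (hg : BddLip K g) {t : ℝ} (ht : t ≤ T) (u : ℝ → F)
    (φ : ℝ → E) : -(K * (T - t) + K) ≤ controlCost c g T t u φ := by
  have h1 : ‖∫ s in 0..(T - t), c (φ s, u s, t + s)‖ ≤ K * |T - t - 0| :=
    intervalIntegral.norm_integral_le_of_norm_le_const fun s _ => hc.bound _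
  have h2 := hg.bound (φ (T - t))
  rw [sub_zero, abs_of_nonneg (sub_nonneg.2 ht), Real.norm_eq_abs] at h1
  rw [Real.norm_eq_abs] at h2
  unfold controlCost
  linarith [neg_le_of_abs_le h1, neg_le_of_abs_le h2]

theorem freeValue_le (hc : BddLip K c) (hg : BddLip K g) {t : ℝ} (ht : t ≤ T) {x : E} {u : ℝ → F}
    {φ : ℝ → E} (h : IsControlled f U L x u φ) :
    freeValue f c g U T L x t ≤ controlCost c g T t u φ :=
  csInf_le ⟨-(K * (T - t) + K), by
    rintro _ ⟨v, ψ, -, rfl⟩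
    exact neg_le_controlCost hc hg ht v ψ⟩ ⟨u, φ, h, rfl⟩

variable [CompleteSpace E]

/-- Existence of solutions is what is needed here: on an empty set of costs `sInf` would be 0. -/
theorem le_freeValue (hf : BddLip K f) (hL : 0 ≤ L) (hU : U.Nonempty) {x : E} {t r : ℝ}
    (h : ∀ u φ, IsControlled f U L x u φ → r ≤ controlCost c g T t u φ) :
    r ≤ freeValue f c g U T L x t := by
  obtain ⟨u₀, hu₀⟩ := hU
  obtain ⟨φ, hφ⟩ := exists_isControlled (U := U) hf hL (measurable_const (a := u₀))
    (fun _ => hu₀) x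
  refine le_csInf ⟨_, _, φ, hφ, rfl⟩ ?_
  rintro _ ⟨u, φ, hφ, rfl⟩
  exact h u φ hφ

theorem freeValue_final (hf : BddLip K f) (hc : BddLip K c) (hg : BddLip K g) (hL : 0 ≤ L)
    (hU : U.Nonempty) (x : E) : freeValue f c g U T L x T = g x := by
  have key : ∀ u φ, IsControlled f U L x u φ → controlCost c g T T u φ = g x := fun u φ h => by
    simp [controlCost, h.apply_zero hL]
  refine le_antisymm ?_ (le_freeValue hf hL hU fun u φ h => (key u φ h).ge)
  obtain ⟨u₀, hu₀⟩ := hU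
  obtain ⟨φ, hφ⟩ := exists_isControlled (U := U) hf hL (measurable_const (a := u₀))
    (fun _ => hu₀) x
  exact (freeValue_le hc hg le_rfl hφ).trans_eq (key _ _ hφ)

/-- An input used from `y` is reused from `x`; by Grönwall the two trajectories stay within
`exp(KL)‖x - y‖`. -/
theorem freeValue_le_add_norm (hf : BddLip K f) (hc : BddLip K c) (hg : BddLip K g)
    (hU : U.Nonempty) {t : ℝ} (ht : t ∈ Icc (T - L) T) (x y : E) :
    freeValue f c g U T L x t
      ≤ freeValue f c g U T L y t + K * Real.exp (K * L) * (L + 1) * ‖x - y‖ := by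
  have hK := hf.nonneg
  have hL : 0 ≤ L := by linarith [ht.1, ht.2]
  rw [← sub_le_iff_le_add]
  refine le_freeValue hf hL hU fun u ψ hψ => ?_
  obtain ⟨φ, hφ⟩ := exists_isControlled (U := U) hf hL hψ.measurable hψ.mem x
  rw [sub_le_iff_le_add]
  refine (freeValue_le hc hg ht.2 hφ).trans ((controlCost_sub_le hc hg hψ.measurable hφ.continuous
    hψ.continuous ht.2 (η := ‖x - y‖ * Real.exp (K * L)) fun s hs =>
      hφ.norm_sub_le_exp hψ hf ⟨hs.1, hs.2.trans (by linarith [ht.1])⟩).trans ?_)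
  have : K * (‖x - y‖ * Real.exp (K * L)) * (T - t + 1)
      ≤ K * (‖x - y‖ * Real.exp (K * L)) * (L + 1) := by
    gcongr
    linarith [ht.1]
  linarith

/-- Clocks start at 0 and run to the fixed horizon `L`, so the same input and trajectory compete at
both starting times; only the cost changes. -/
theorem freeValue_le_add_abs (hf : BddLip K f) (hc : BddLip K c) (hg : BddLip K g)
    (hU : U.Nonempty) {t t' : ℝ} (ht : t ∈ Icc (T - L) T) (ht' : t' ∈ Icc (T - L) T) (x : E) :
    freeValue f c g U T L x t
      ≤ freeValue f c g U T L x t' + (K * L + K + K * K) * |t - t'| := by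
  have hK := hf.nonneg
  have hL : 0 ≤ L := by linarith [ht.1, ht.2]
  rw [← sub_le_iff_le_add]
  refine le_freeValue hf hL hU fun u φ hφ => ?_
  rw [sub_le_iff_le_add]
  refine (freeValue_le hc hg ht.2 hφ).trans ?_
  have hi := fun t a b => hc.intervalIntegrable_cost hφ.measurable hφ.continuous t a b
  have h1 : ‖∫ s in 0..(T - t), (c (φ s, u s, t + s) - c (φ s, u s, t' + s))‖
      ≤ K * |t - t'| * |T - t - 0| :=
    intervalIntegral.norm_integral_le_of_norm_le_const fun s _ => by
      refine (hc.lip _ _).trans ?_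
      gcongr
      simp [Prod.norm_def]
  rw [intervalIntegral.integral_sub (hi _ _ _) (hi _ _ _), sub_zero,
    abs_of_nonneg (sub_nonneg.2 ht.2), Real.norm_eq_abs] at h1
  have h2 : ‖∫ s in (T - t')..(T - t), c (φ s, u s, t' + s)‖ ≤ K * |(T - t) - (T - t')| :=
    intervalIntegral.norm_integral_le_of_norm_le_const fun s _ => hc.bound _
  have h3 := intervalIntegral.integral_add_adjacent_intervals (hi t' 0 (T - t'))
    (hi t' (T - t') (T - t))
  have habs : |(T - t) - (T - t')| = |t - t'| := by rw [abs_sub_comm]; congr 1; ring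
  have h4 : |g (φ (T - t)) - g (φ (T - t'))| ≤ K * (K * |t - t'|) := by
    refine (hg.lip _ _).trans ?_
    gcongr
    rw [← habs]
    exact hφ.norm_sub_le hf ⟨by linarith [ht'.2], by linarith [ht'.1]⟩
      ⟨by linarith [ht.2], by linarith [ht.1]⟩
  rw [habs, Real.norm_eq_abs] at h2
  have h5 : K * |t - t'| * (T - t) ≤ K * |t - t'| * L := by
    gcongr
    linarith [ht.1]
  unfold controlCost
  linarith [le_of_abs_le h1, le_of_abs_le h2, le_of_abs_le h4]

/-- One step of dynamic programming with a constant input and an Euler step for the state. -/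
theorem freeValue_le_euler_step (hf : BddLip K f) (hc : BddLip K c) (hg : BddLip K g) {u₀ : F}
    (hu₀ : u₀ ∈ U) {t h : ℝ} (ht : T - L ≤ t) (hh : 0 ≤ h) (hth : t + h ≤ T) (x : E) :
    freeValue f c g U T L x t ≤ h * c (x, u₀, t)
      + freeValue f c g U T L (x + h • f (x, u₀)) (t + h)
      + (K * (K + 1) + K * (K * K * Real.exp (K * L)) * (L + 1)) * h ^ 2 := by
  have hK := hf.nonneg
  have hhL : h ≤ L := by linarith
  have hL : 0 ≤ L := hh.trans hhL
  rw [← sub_le_iff_le_add, ← sub_le_iff_le_add']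
  refine le_freeValue hf hL ⟨u₀, hu₀⟩ fun u ψ hψ => ?_
  rw [sub_le_iff_le_add', sub_le_iff_le_add]
  -- Play `u₀` up to time `h`, then the input `u` of the trajectory `ψ` that starts at the Euler
  -- point.
  set v : ℝ → F := fun s => if s < h then u₀ else u (s - h) with hv
  have hvm : Measurable v := Measurable.ite measurableSet_Iio measurable_const
    (hψ.measurable.comp (measurable_id.sub_const h))
  obtain ⟨φ, hφ⟩ := exists_isControlled (U := U) hf hL hvm
    (fun s => by simp only [hv]; split_ifs; exacts [hu₀, hψ.mem _]) x
  refine (freeValue_le hc hg (by linarith) hφ).trans ?_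
  have hφ0 : φ 0 = x := hφ.apply_zero hL
  have hlip : ∀ s ∈ Icc 0 h, ‖φ s - x‖ ≤ K * s := fun s hs => by
    have := hφ.norm_sub_le hf (s := 0) (t := s) ⟨le_rfl, hL⟩ ⟨hs.1, hs.2.trans hhL⟩
    rwa [hφ0, sub_zero, abs_of_nonneg hs.1] at this
  have hvh : ∀ r, 0 ≤ r → v (r + h) = u r := fun r hr => by
    simp [hv, not_lt.2 hr]
  have hχ : IsControlled f U (L - h) (φ h) u fun s => φ (s + h) := by
    refine ⟨hψ.measurable, hψ.mem, hφ.continuous.comp (continuous_id.add continuous_const),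
      fun s hs => ?_⟩
    have h1 := hφ.sub_eq_integral hf (s := h) (t := s + h) ⟨hh, hhL⟩
      ⟨by linarith [hs.1], by linarith [hs.2]⟩
    rw [← sub_eq_iff_eq_add', h1]
    have h2 := intervalIntegral.integral_comp_add_right (a := 0) (b := s)
      (fun r => f (φ r, v r)) h
    rw [zero_add] at h2
    rw [← h2]
    refine intervalIntegral.integral_congr fun r hr => ?_
    rw [uIcc_of_le hs.1] at hr
    simp only [hvh r hr.1]
  have hstep : ‖φ h - (x + h • f (x, u₀))‖ ≤ K * K * h ^ 2 := by
    have h1 : φ h - (x + h • f (x, u₀)) = ∫ s in 0..h, (f (φ s, v s) - f (x, u₀)) := by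
      rw [intervalIntegral.integral_sub (hf.intervalIntegrable_field hvm hφ.continuous _ _)
        intervalIntegrable_const, ← hφ.sub_eq_integral hf ⟨le_rfl, hL⟩ ⟨hh, hhL⟩, hφ0,
        intervalIntegral.integral_const, sub_zero]
      abel
    rw [h1]
    have h2 : ‖∫ s in 0..h, (f (φ s, v s) - f (x, u₀))‖ ≤ K * (K * h) * |h - 0| := by
      refine intervalIntegral.norm_integral_le_of_norm_le_const_ae ?_
      -- At `s = h` the input `v` has already switched to `u`.
      filter_upwards [Measure.ae_ne volume h] with s hsh hs
      rw [uIoc_of_le hh] at hs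
      have hvs : v s = u₀ := by simp [hv, lt_of_le_of_ne hs.2 hsh]
      rw [hvs]
      refine (hf.lip _ _).trans ?_
      have h3 := (hlip s ⟨hs.1.le, hs.2⟩).trans (mul_le_mul_of_nonneg_left hs.2 hK)
      gcongr
      simpa [Prod.norm_def] using h3
    rw [sub_zero, abs_of_nonneg hh] at h2
    linarith
  have hclose : ∀ s ∈ Icc 0 (T - (t + h)),
      ‖φ (s + h) - ψ s‖ ≤ K * K * h ^ 2 * Real.exp (K * L) := fun s hs => by
    refine (hχ.norm_sub_le_exp (hψ.mono (by linarith)) hf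
      ⟨hs.1, hs.2.trans (by linarith)⟩).trans ?_
    gcongr
    linarith
  have hcost := controlCost_sub_le hc hg hψ.measurable hχ.continuous hψ.continuous hth hclose
  have hi := fun a b => hc.intervalIntegrable_cost hvm hφ.continuous t a b
  have hsplit : controlCost c g T t v φ = (∫ s in 0..h, c (φ s, v s, t + s))
      + controlCost c g T (t + h) u fun s => φ (s + h) := by
    unfold controlCost
    rw [← intervalIntegral.integral_add_adjacent_intervals (hi 0 h) (hi h (T - t)), add_assoc]
    congr 2
    · have h2 := intervalIntegral.integral_comp_add_right (a := 0) (b := T - (t + h))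
        (fun r => c (φ r, v r, t + r)) h
      rw [zero_add, show T - (t + h) + h = T - t by ring] at h2
      rw [← h2]
      refine intervalIntegral.integral_congr fun r hr => ?_
      rw [uIcc_of_le (by linarith)] at hr
      simp only [hvh r hr.1]
      rw [add_assoc t, add_comm h]
    · congr 2
      ring
  have hfirst : ‖∫ s in 0..h, (c (φ s, v s, t + s) - c (x, u₀, t))‖
      ≤ K * ((K + 1) * h) * |h - 0| := by
    refine intervalIntegral.norm_integral_le_of_norm_le_const_ae ?_
    filter_upwards [Measure.ae_ne volume h] with s hsh hs
    rw [uIoc_of_le hh] at hs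
    have hvs : v s = u₀ := by simp [hv, lt_of_le_of_ne hs.2 hsh]
    rw [hvs]
    refine (hc.lip _ _).trans ?_
    have h3 := (hlip s ⟨hs.1.le, hs.2⟩).trans (mul_le_mul_of_nonneg_left hs.2 hK)
    have h4 : 0 ≤ K * h := by positivity
    gcongr
    simp only [Prod.norm_def, Prod.fst_sub, Prod.snd_sub, sub_self, norm_zero, add_sub_cancel_left,
      Real.norm_eq_abs, abs_of_pos hs.1]
    refine max_le (by linarith) (max_le (by linarith) (by linarith [hs.2]))
  rw [intervalIntegral.integral_sub (hi _ _) intervalIntegrable_const,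
    intervalIntegral.integral_const, sub_zero, abs_of_nonneg hh, smul_eq_mul,
    Real.norm_eq_abs] at hfirst
  have hlast : K * (K * K * h ^ 2 * Real.exp (K * L)) * (T - (t + h) + 1)
      ≤ K * (K * K * h ^ 2 * Real.exp (K * L)) * (L + 1) := by
    gcongr
    linarith
  rw [hsplit]
  linarith [le_of_abs_le hfirst]

end ValueFunction

/-! ### A Lipschitz subsolution beyond the time interval. -/

section ExtendedValue

variable {E F : Type*} [NormedAddCommGroup E] [NormedSpace ℝ E] [NormedAddCommGroup F]
  [MeasurableSpace E] [BorelSpace E] [SecondCountableTopology E] [CompleteSpace E]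
  [MeasurableSpace F] [BorelSpace F] [SecondCountableTopology F]
  {f : E × F → E} {c : E × F × ℝ → ℝ} {g : E → ℝ} {U : Set F} {K L T : ℝ}

/-- The value function extended to all times: constant before `T - L`, and with a slope after `T`
that keeps it a subsolution of the Hamilton–Jacobi–Bellman equation. -/
noncomputable def extendedValue (f : E × F → E) (c : E × F × ℝ → ℝ) (g : E → ℝ) (U : Set F)
    (K T L : ℝ) (z : E × ℝ) : ℝ :=
  freeValue f c g U T L z.1 (max (T - L) (min T z.2)) + (K * K + K) * max 0 (z.2 - T)

theorem extendedValue_eq (x : E) {t : ℝ} (ht : t ∈ Icc (T - L) T) :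
    extendedValue f c g U K T L (x, t) = freeValue f c g U T L x t := by
  simp [extendedValue, ht.1, ht.2]

theorem extendedValue_of_le (hf : BddLip K f) (hc : BddLip K c) (hg : BddLip K g) (hL : 0 ≤ L)
    (hU : U.Nonempty) (x : E) {t : ℝ} (ht : T ≤ t) :
    extendedValue f c g U K T L (x, t) = g x + (K * K + K) * (t - T) := by
  simp only [extendedValue]
  rw [min_eq_left ht, max_eq_right (by linarith), freeValue_final hf hc hg hL hU,
    max_eq_right (by linarith)]

theorem lipschitzWith_extendedValue (hf : BddLip K f) (hc : BddLip K c) (hg : BddLip K g)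
    (hL : 0 ≤ L) (hU : U.Nonempty) :
    ∃ κ, LipschitzWith κ (extendedValue f c g U K T L) := by
  have hK := hf.nonneg
  refine ⟨(K * Real.exp (K * L) * (L + 1) + (K * L + K + K * K) + (K * K + K)).toNNReal,
    LipschitzWith.of_le_add_mul _ fun z z' => ?_⟩
  rw [Real.coe_toNNReal _ (by positivity), dist_eq_norm]
  have hmem : ∀ t, max (T - L) (min T t) ∈ Icc (T - L) T := fun t =>
    ⟨le_max_left _ _, max_le (by linarith) (min_le_left _ _)⟩
  have h1 := freeValue_le_add_norm hf hc hg hU (hmem z.2) z.1 z'.1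
  have h2 := freeValue_le_add_abs hf hc hg hU (hmem z.2) (hmem z'.2) z'.1
  have h3 : |max (T - L) (min T z.2) - max (T - L) (min T z'.2)| ≤ |z.2 - z'.2| := by
    have := ((LipschitzWith.id.const_min T).const_max (T - L)).dist_le_mul z.2 z'.2
    simpa [Real.dist_eq] using this
  have h4 : |max 0 (z.2 - T) - max 0 (z'.2 - T)| ≤ |z.2 - z'.2| := by
    simpa using abs_max_sub_max_le_abs (z.2 - T) (z'.2 - T) 0 |>.trans_eq (by ring_nf)
      |> (by rw [max_comm 0, max_comm 0]; exact ·)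
  have h5 : ‖z.1 - z'.1‖ ≤ ‖z - z'‖ := norm_fst_le (z - z')
  have h6 : |z.2 - z'.2| ≤ ‖z - z'‖ := norm_snd_le (z - z')
  have h7 : K * Real.exp (K * L) * (L + 1) * ‖z.1 - z'.1‖
      ≤ K * Real.exp (K * L) * (L + 1) * ‖z - z'‖ := by gcongr
  have h8 := mul_le_mul_of_nonneg_left (h3.trans h6) (by positivity : 0 ≤ K * L + K + K * K)
  have h9 := mul_le_mul_of_nonneg_left ((le_of_abs_le h4).trans h6)
    (by positivity : 0 ≤ K * K + K)
  unfold extendedValue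
  linarith

/-- After `T`, one unit of time changes `g` along the field by at most `K * K` and costs at least
`-K`; the slope `K * K + K` pays for both. A step across `T` is split there. -/
theorem extendedValue_le_euler_step (hf : BddLip K f) (hc : BddLip K c) (hg : BddLip K g)
    {u₀ : F} (hu₀ : u₀ ∈ U) (hL : 0 ≤ L) {t h : ℝ} (ht : T - L ≤ t) (hh : 0 ≤ h) (x : E) :
    extendedValue f c g U K T L (x, t) ≤ h * c (x, u₀, t)
      + extendedValue f c g U K T L (x + h • f (x, u₀), t + h)
      + (K * (K + 1) + K * (K * K * Real.exp (K * L)) * (L + 1)) * h ^ 2 := by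
  have hK := hf.nonneg
  set C := K * (K + 1) + K * (K * K * Real.exp (K * L)) * (L + 1) with hC
  have hC0 : 0 ≤ C := by positivity
  have hcb : -K ≤ c (x, u₀, t) := neg_le_of_abs_le (hc.bound _)
  have hgl : ∀ a b : ℝ, g (x + a • f (x, u₀)) ≤ g (x + b • f (x, u₀)) + K * K * |a - b| :=
    fun a b => by
      have h1 := le_of_abs_le (hg.lip (x + a • f (x, u₀)) (x + b • f (x, u₀)))
      rw [add_sub_add_left_eq_sub, ← sub_smul, norm_smul, Real.norm_eq_abs] at h1
      have h2 : K * (|a - b| * ‖f (x, u₀)‖) ≤ K * (|a - b| * K) := by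
        gcongr
        exact hf.bound _
      linarith
  rcases le_total T t with hTt | htT
  · rw [extendedValue_of_le hf hc hg hL ⟨u₀, hu₀⟩ _ hTt,
      extendedValue_of_le hf hc hg hL ⟨u₀, hu₀⟩ _ (by linarith)]
    have h1 := hgl 0 h
    rw [zero_smul, add_zero, zero_sub, abs_neg, abs_of_nonneg hh] at h1
    have h2 := mul_le_mul_of_nonneg_left hcb hh
    have h3 := mul_nonneg hC0 (sq_nonneg h)
    linarith
  rcases le_total (t + h) T with hth | hth
  · rw [extendedValue_eq _ ⟨ht, htT⟩, extendedValue_eq _ ⟨by linarith, hth⟩]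
    exact freeValue_le_euler_step hf hc hg hu₀ ht hh hth x
  · have h1 := freeValue_le_euler_step hf hc hg hu₀ (L := L) (h := T - t) ht (by linarith)
      (by linarith) x
    rw [add_sub_cancel, freeValue_final hf hc hg hL ⟨u₀, hu₀⟩, ← hC] at h1
    rw [extendedValue_eq _ ⟨ht, htT⟩, extendedValue_of_le hf hc hg hL ⟨u₀, hu₀⟩ _ hth]
    have h2 := hgl (T - t) h
    rw [abs_of_nonpos (by linarith)] at h2
    have h3 := mul_le_mul_of_nonneg_left hcb (by linarith : 0 ≤ h - (T - t))
    have h4 : C * (T - t) ^ 2 ≤ C * h ^ 2 := by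
      gcongr
      linarith
    linarith

/-- The dissipation inequality for translates of the extended value function. -/
theorem exists_extendedValue_translate_ge (hf : BddLip K f) (hc : BddLip K c) (hg : BddLip K g)
    (hL : 0 ≤ L) (hU : U.Nonempty) :
    ∃ C, 0 ≤ C ∧ ∀ u ∈ U, ∀ z y : E × ℝ, T - L ≤ z.2 - y.2 → ∀ h, 0 ≤ h →
      -(h * (c (z.1, u, z.2) + C * ‖y‖)) - C * h ^ 2 ≤
        extendedValue f c g U K T L (z - y + h • (f (z.1, u), (1 : ℝ)))
          - extendedValue f c g U K T L (z - y) := by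
  have hK := hf.nonneg
  obtain ⟨κ, hκ⟩ := lipschitzWith_extendedValue (T := T) hf hc hg hL hU
  set C := K * (K + 1) + K * (K * K * Real.exp (K * L)) * (L + 1)
  have hC0 : 0 ≤ C := by positivity
  refine ⟨C + κ * K + K, by positivity, fun u hu z y hzy h hh => ?_⟩
  have h1 := extendedValue_le_euler_step hf hc hg hu hL hzy hh (z.1 - y.1)
  -- The Euler step at `z - y` uses the field at `z - y`; replacing it by the field at `z` costs `κ
  -- * K * h * ‖y‖`.
  have h2 := hκ.dist_le_mul (z.1 - y.1 + h • f (z.1 - y.1, u), z.2 - y.2 + h)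
    (z - y + h • (f (z.1, u), (1 : ℝ)))
  have h3 : dist (z.1 - y.1 + h • f (z.1 - y.1, u), z.2 - y.2 + h)
      (z - y + h • (f (z.1, u), (1 : ℝ))) ≤ h * (K * ‖y‖) := by
    rw [dist_eq_norm]
    have h4 : (z.1 - y.1 + h • f (z.1 - y.1, u), z.2 - y.2 + h)
        - (z - y + h • (f (z.1, u), (1 : ℝ))) = (h • (f (z.1 - y.1, u) - f (z.1, u)), (0 : ℝ)) := by
      ext
      · simp [smul_sub]
      · simp
    rw [h4, Prod.norm_mk, norm_zero, max_eq_left (norm_nonneg _), norm_smul, Real.norm_of_nonneg hh]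
    gcongr
    refine (hf.lip _ _).trans ?_
    gcongr
    simp [Prod.norm_def]
  have h5 : c (z.1 - y.1, u, z.2 - y.2) ≤ c (z.1, u, z.2) + K * ‖y‖ := by
    have := le_of_abs_le (hc.lip (z.1 - y.1, u, z.2 - y.2) (z.1, u, z.2))
    have h6 : ‖(z.1 - y.1, u, z.2 - y.2) - (z.1, u, z.2)‖ ≤ ‖y‖ := by
      simp [Prod.norm_def]
    have h7 := mul_le_mul_of_nonneg_left h6 hK
    linarith
  have h8 := le_of_abs_le (Real.dist_eq _ _ ▸ h2)
  have h9 := mul_le_mul_of_nonneg_left h3 κ.2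
  have h10 := mul_le_mul_of_nonneg_left h5 hh
  have h11 : 0 ≤ (κ * K + K) * h ^ 2 := by positivity
  have h12 : 0 ≤ h * (C * ‖y‖) := by positivity
  change extendedValue f c g U K T L (z - y) ≤ _ at h1
  simp only [NNReal.val_eq_coe] at h9
  linarith

end ExtendedValue

/-! ### Polynomials along curves and polynomial mollification. -/

section Polynomials

open MvPolynomial

theorem MvPolynomial.hasDerivAt_eval {σ : Type*} [Fintype σ] (p : MvPolynomial σ ℝ)
    {γ : ℝ → σ → ℝ} {γ' : σ → ℝ} {s : ℝ} (h : ∀ o, HasDerivAt (fun r => γ r o) (γ' o) s) :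
    HasDerivAt (fun r => eval (γ r) p) (∑ o, eval (γ s) (pderiv o p) * γ' o) s := by
  classical
  induction p using MvPolynomial.induction_on with
  | C a => simpa using hasDerivAt_const s a
  | add p q hp hq =>
    simp only [map_add, add_mul, Finset.sum_add_distrib]
    exact hp.add hq
  | mul_X p i hp =>
    simp only [map_mul, eval_X]
    refine (hp.mul (h i)).congr_deriv ?_
    simp only [Derivation.leibniz, smul_eq_mul, map_add, map_mul, pderiv_X, eval_X, add_mul,
      Finset.sum_add_distrib]
    rw [add_comm, Finset.sum_mul]
    congr 1
    · rw [Finset.sum_eq_single i (fun j _ hj => by simp [hj.symm]) (by simp)]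
      simp
    · exact Finset.sum_congr rfl fun j _ => by ring

theorem MvPolynomial.absolutelyContinuousOnInterval_eval {σ : Type*} (p : MvPolynomial σ ℝ)
    {γ : ℝ → σ → ℝ} {a b : ℝ}
    (h : ∀ o, AbsolutelyContinuousOnInterval (fun r => γ r o) a b) :
    AbsolutelyContinuousOnInterval (fun r => eval (γ r) p) a b := by
  induction p using MvPolynomial.induction_on with
  | C c =>
    simpa using ((LipschitzWith.const c).lipschitzOnWith
      (s := uIcc a b)).absolutelyContinuousOnInterval
  | add p q hp hq =>
    simp only [map_add]
    exact hp.fun_add hq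
  | mul_X p i hp =>
    simp only [map_mul, eval_X]
    exact hp.fun_mul (h i)

variable {n : ℕ}

theorem continuous_polyEval (J : MvPolynomial (Option (Fin n)) ℝ) : Continuous (polyEval J) := by
  refine (MvPolynomial.continuous_eval J).comp (continuous_pi fun o => ?_)
  cases o with
  | none => exact continuous_snd
  | some i => exact (PiLp.continuous_apply 2 _ i).comp continuous_fst

theorem hasDerivAt_polyEval_line (J : MvPolynomial (Option (Fin n)) ℝ)
    (z v : EuclideanSpace ℝ (Fin n) × ℝ) :
    HasDerivAt (fun h : ℝ => polyEval J (z + h • v))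
      (polyEval (pderiv none J) z * v.2 + ∑ i, polyEval (pderiv (some i) J) z * v.1 i) 0 := by
  refine (J.hasDerivAt_eval (γ' := fun o => o.elim v.2 (fun i => v.1 i)) fun o => ?_).congr_deriv ?_
  · cases o with
    | none => simpa using ((hasDerivAt_id (0 : ℝ)).mul_const v.2).const_add z.2
    | some i => simpa using ((hasDerivAt_id (0 : ℝ)).mul_const (v.1 i)).const_add (z.1 i)
  · rw [Fintype.sum_option]
    simp [polyEval]

/-- The convolution of a compactly supported function with a polynomial is a polynomial. -/
theorem exists_polyEval_eq_convolution (q : MvPolynomial (Option (Fin n)) ℝ)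
    {W : EuclideanSpace ℝ (Fin n) × ℝ → ℝ} (hW : Continuous W) (hWs : HasCompactSupport W) :
    ∃ p, ∀ z, polyEval p z = ∫ y, W y * polyEval q (z - y) := by
  have hint : ∀ (q : MvPolynomial (Option (Fin n)) ℝ)
      {W : EuclideanSpace ℝ (Fin n) × ℝ → ℝ} (_ : Continuous W) (_ : HasCompactSupport W) z,
      Integrable fun y => W y * polyEval q (z - y) := fun q W hW hWs z =>
    (hW.mul ((continuous_polyEval q).comp (continuous_const.sub continuous_id))
      ).integrable_of_hasCompactSupport hWs.mul_right
  induction q using MvPolynomial.induction_on generalizing W with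
  | C a =>
    refine ⟨C (∫ y, W y * a), fun z => ?_⟩
    simp [polyEval]
  | add q₁ q₂ h₁ h₂ =>
    obtain ⟨p₁, hp₁⟩ := h₁ hW hWs
    obtain ⟨p₂, hp₂⟩ := h₂ hW hWs
    refine ⟨p₁ + p₂, fun z => ?_⟩
    have : polyEval (p₁ + p₂) z = polyEval p₁ z + polyEval p₂ z := by simp [polyEval]
    rw [this, hp₁, hp₂, ← integral_add (hint q₁ hW hWs z) (hint q₂ hW hWs z)]
    exact integral_congr_ae (ae_of_all _ fun y => by simp [polyEval, mul_add])
  -- A coordinate of `z - y` is a difference of coordinates; the one of `y` is absorbed into the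
  -- weight, which is why the induction generalizes `W`.
  | mul_X q o h =>
    have hX := continuous_polyEval (n := n) (X o)
    obtain ⟨p₁, hp₁⟩ := h hW hWs
    obtain ⟨p₂, hp₂⟩ := h (hW.mul hX) hWs.mul_right
    refine ⟨X o * p₁ - p₂, fun z => ?_⟩
    have : polyEval (X o * p₁ - p₂) z = polyEval (X o) z * polyEval p₁ z - polyEval p₂ z := by
      simp [polyEval]
    rw [this, hp₁, hp₂, ← integral_const_mul,
      ← integral_sub ((hint q hW hWs z).const_mul _) (hint q (hW.mul hX) hWs.mul_right z)]
    refine integral_congr_ae (ae_of_all _ fun y => ?_)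
    have h1 : polyEval (q * X o) (z - y)
        = polyEval q (z - y) * (polyEval (X o) z - polyEval (X o) y) := by
      cases o <;> simp [polyEval]
    simp only [h1, Pi.mul_apply]
    ring

/-- Polynomial approximate identities on a ball. -/
theorem exists_peak_polynomial {r η : ℝ} (hr : 0 < r) (hη : 0 < η) :
    ∃ q : MvPolynomial (Option (Fin n)) ℝ,
      (∀ y ∈ Metric.closedBall 0 r, 0 ≤ polyEval q y) ∧
      (∫ y in Metric.closedBall 0 r, polyEval q y = 1) ∧
      ∫ y in Metric.closedBall 0 r, polyEval q y * ‖y‖ ≤ η := by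
  set s := Metric.closedBall (0 : EuclideanSpace ℝ (Fin n) × ℝ) r
  -- A Landau kernel: the normalized powers of `q₀` concentrate at its unique maximum 0. The norm of
  -- the product is a maximum, so the sum of squares reaches up to `2 * r ^ 2` on the ball.
  set q₀ : MvPolynomial (Option (Fin n)) ℝ := 1 - C (2 * r ^ 2)⁻¹ * ∑ o, X o ^ 2 with hq₀
  have hq : ∀ y, polyEval q₀ y = 1 - (2 * r ^ 2)⁻¹ * (y.2 ^ 2 + ‖y.1‖ ^ 2) := fun y => by
    simp [hq₀, polyEval, Fintype.sum_option, EuclideanSpace.norm_sq_eq]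
  have hpos : ∀ y ∈ s, 0 ≤ polyEval q₀ y := fun y hy => by
    have hy' : ‖y‖ ≤ r := by simpa [s] using hy
    have h1 : ‖y.1‖ ^ 2 ≤ r ^ 2 := by gcongr; exact (norm_fst_le y).trans hy'
    have h2 : y.2 ^ 2 ≤ r ^ 2 := by
      rw [← sq_abs]
      gcongr
      exact (norm_snd_le y).trans hy'
    rw [hq, sub_nonneg, inv_mul_le_iff₀ (by positivity)]
    linarith
  have key : ∀ g : EuclideanSpace ℝ (Fin n) × ℝ → ℝ, Continuous g →
      Tendsto (fun N : ℕ => (∫ y in s, polyEval q₀ y ^ N)⁻¹ • ∫ y in s, polyEval q₀ y ^ N • g y)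
        atTop (𝓝 (g 0)) := fun g hg => by
    refine tendsto_setIntegral_pow_smul_of_unique_maximum_of_isCompact_of_continuousOn
      (isCompact_closedBall _ _) (continuous_polyEval q₀).continuousOn (fun y _ hy0 => ?_) hpos
      ?_ ?_ hg.continuousOn
    · rw [hq, hq]
      have : 0 < y.2 ^ 2 + ‖y.1‖ ^ 2 := by
        by_cases h : y.2 = 0
        · have : y.1 ≠ 0 := fun h' => hy0 (Prod.ext h' h)
          positivity
        · positivity
      have : 0 < (2 * r ^ 2)⁻¹ * (y.2 ^ 2 + ‖y.1‖ ^ 2) := by positivity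
      simpa using this
    · simp [hq]
    · refine subset_closure (Metric.ball_subset_interior_closedBall ?_)
      simpa using hr
  have h1 := key (fun _ => 1) continuous_const
  have h2 := key (fun y => ‖y‖) continuous_norm
  simp only [norm_zero] at h2
  obtain ⟨N, hN1, hN2⟩ := ((h1.eventually (lt_mem_nhds (by norm_num : (0 : ℝ) < 1))).and
    (h2.eventually (gt_mem_nhds hη))).exists
  set I := ∫ y in s, polyEval q₀ y ^ N
  have hqN : ∀ y, polyEval (C I⁻¹ * q₀ ^ N) y = I⁻¹ * polyEval q₀ y ^ N := fun y => by
    simp [polyEval]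
  have hI : 0 ≤ I := setIntegral_nonneg measurableSet_closedBall fun y hy =>
    pow_nonneg (hpos y hy) N
  have hI0 : I ≠ 0 := fun h => by simp [h] at hN1
  refine ⟨C I⁻¹ * q₀ ^ N, fun y hy => ?_, ?_, ?_⟩
  · rw [hqN]
    exact mul_nonneg (inv_nonneg.2 hI) (pow_nonneg (hpos y hy) N)
  · simp only [hqN, integral_const_mul]
    exact inv_mul_cancel₀ hI0
  · simp only [hqN, mul_assoc, integral_const_mul]
    exact hN2.le

/-- A Lipschitz function agrees on a ball, up to a constant, with one of bounded support. -/
theorem LipschitzWith.exists_cutoff {E : Type*} [SeminormedAddCommGroup E] {W : E → ℝ} {κ : ℝ≥0}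
    (hW : LipschitzWith κ W) {r : ℝ} (hr : 0 ≤ r) :
    ∃ (W' : E → ℝ) (κ' : ℝ≥0) (a R : ℝ), LipschitzWith κ' W' ∧ 0 ≤ R ∧
      (∀ z, ‖z‖ ≤ r → W' z = W z + a) ∧ ∀ z, R < ‖z‖ → W' z = 0 := by
  set a := |W 0| + κ * r
  have hb : ∀ z, |W z| ≤ |W 0| + κ * ‖z‖ := fun z => by
    have := hW.dist_le_mul z 0
    rw [dist_zero_right, Real.dist_eq] at this
    linarith [abs_sub_abs_le_abs_sub (W z) (W 0)]
  have hρ : LipschitzWith (κ + 1) fun z : E => ((κ + 1 : ℝ≥0) : ℝ) * max 0 (‖z‖ - r) :=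
    LipschitzWith.of_dist_le_mul fun x y => by
      rw [Real.dist_eq, ← mul_sub, abs_mul, NNReal.abs_eq]
      gcongr
      have h1 := (((LipschitzWith.id.const_max (r : ℝ)).comp (lipschitzWith_one_norm (E := E))
        ).dist_le_mul x y)
      simp only [Function.comp, id, Real.dist_eq, mul_one, NNReal.coe_one, one_mul] at h1
      have h2 : ∀ w : E, max 0 (‖w‖ - r) = max r ‖w‖ - r := fun w => by
        rw [← max_sub_sub_right, sub_self]
      rwa [h2, h2, sub_sub_sub_cancel_right]
  -- The shift `a` makes `W + a` nonnegative on the ball of radius `r`; outside it the slope `κ + 1`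
  -- outruns the growth of `W`.
  refine ⟨fun z => max 0 (W z + a - ((κ + 1 : ℝ≥0) : ℝ) * max 0 (‖z‖ - r)), κ + (κ + 1), a,
    |W 0| + a + (κ + 1) * r, ?_, by positivity, fun z hz => ?_, fun z hz => ?_⟩
  · refine LipschitzWith.const_max (LipschitzWith.sub ?_ hρ) 0
    simpa using hW.add (LipschitzWith.const a)
  · have h1 := neg_le_of_abs_le (hb z)
    have h2 : (κ : ℝ) * ‖z‖ ≤ κ * r := by gcongr
    simp only
    rw [max_eq_left (by linarith : ‖z‖ - r ≤ 0), mul_zero, sub_zero, max_eq_right (by linarith)]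
  · have h1 := le_of_abs_le (hb z)
    have h2 : ((κ : ℝ) + 1) * (‖z‖ - r) ≤ (κ + 1) * max 0 (‖z‖ - r) := by
      gcongr
      exact le_max_right _ _
    refine max_eq_left ?_
    push_cast
    linarith

/-- Polynomial approximation of a Lipschitz function that preserves one-sided bounds on
directional difference quotients. -/
theorem LipschitzWith.exists_polyEval_approx {W : EuclideanSpace ℝ (Fin n) × ℝ → ℝ} {κ : ℝ≥0}
    (hW : LipschitzWith κ W) {R M D ε : ℝ} (hR : 0 ≤ R) (hM : 0 ≤ M) (hD : 0 ≤ D) (hε : 0 < ε) :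
    ∃ J : MvPolynomial (Option (Fin n)) ℝ, (∀ z, ‖z‖ ≤ R → |polyEval J z - W z| ≤ ε) ∧
      ∀ (z v : EuclideanSpace ℝ (Fin n) × ℝ) (b : ℝ), ‖z‖ ≤ R → ‖v‖ ≤ M → |b| ≤ M →
        (∀ y, ‖y‖ ≤ 1 → ∀ h ∈ Icc (0 : ℝ) 1,
          -(h * (b + D * ‖y‖)) - D * h ^ 2 ≤ W (z - y + h • v) - W (z - y)) →
        -b - ε ≤ polyEval (pderiv none J) z * v.2
          + ∑ i, polyEval (pderiv (some i) J) z * v.1 i := by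
  obtain ⟨W', κ', a, R₁, hW', hR₁, hWW', hsupp⟩ :=
    hW.exists_cutoff (by positivity : 0 ≤ R + 1 + M)
  have : (volume : Measure (EuclideanSpace ℝ (Fin n) × ℝ)).IsAddHaarMeasure :=
    inferInstanceAs
      ((volume : Measure (EuclideanSpace ℝ (Fin n))).prod (volume : Measure ℝ)).IsAddHaarMeasure
  -- The extra `κ' * M + M` covers `1 ≤ ‖y‖`, where the hypothesis says nothing and only the
  -- Lipschitz bound is available.
  set D' : ℝ := D + κ' * M + M
  set η := ε / (D' + κ' + 1)
  have hη : 0 < η := by positivity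
  have hη1 : (D' + κ' + 1) * η = ε := mul_div_cancel₀ _ (by positivity)
  have hDη : D' * η ≤ ε := by nlinarith [κ'.2, hη.le]
  have hκη : κ' * η ≤ ε := by
    have : 0 ≤ D' * η := by positivity
    linarith
  have hcs : HasCompactSupport W' := HasCompactSupport.intro (isCompact_closedBall 0 R₁)
    fun z hz => hsupp z (by simpa using hz)
  -- The radius is so large that for `‖z‖ ≤ R + M` the factor `W' (z - y)` vanishes wherever `q` is
  -- uncontrolled.
  obtain ⟨q, hq0, hq1, hqη⟩ :=
    exists_peak_polynomial (n := n) (by positivity : 0 < R₁ + (R + M) + 1) hη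
  set s := Metric.closedBall (0 : EuclideanSpace ℝ (Fin n) × ℝ) (R₁ + (R + M) + 1)
  obtain ⟨J, hJ⟩ := exists_polyEval_eq_convolution q hW'.continuous hcs
  have hqc := continuous_polyEval q
  have hint : ∀ k : EuclideanSpace ℝ (Fin n) × ℝ → ℝ, Continuous k → IntegrableOn k s :=
    fun k hk => hk.continuousOn.integrableOn_compact (isCompact_closedBall _ _)
  have hJs : ∀ z, ‖z‖ ≤ R + M → polyEval J z = ∫ y in s, W' (z - y) * polyEval q y := by
    intro z hz
    rw [hJ, ← integral_sub_left_eq_self _ _ z, setIntegral_eq_integral_of_forall_compl_eq_zero]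
    · simp
    · intro y hy
      have hy' : R₁ + (R + M) + 1 < ‖y‖ := by simpa [s] using hy
      rw [hsupp, zero_mul]
      linarith [norm_sub_norm_le y z, norm_sub_rev y z]
  refine ⟨J - C a, fun z hz => ?_, fun z v b hz hv hb hyp => ?_⟩
  · have h1 : polyEval (J - C a) z - W z = ∫ y in s, (W' (z - y) - W' z) * polyEval q y := by
      have h2 : polyEval (J - C a) z = polyEval J z - a := by simp [polyEval]
      have h3 : W' z = W z + a := hWW' z (by linarith)
      simp only [sub_mul]
      rw [integral_sub (hint _ (by have := hW'.continuous; fun_prop)) (hint _ (by fun_prop)),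
        integral_const_mul, hq1, h2, hJs z (by linarith), h3]
      ring
    rw [h1, ← Real.norm_eq_abs]
    calc ‖∫ y in s, (W' (z - y) - W' z) * polyEval q y‖
        ≤ ∫ y in s, κ' * (polyEval q y * ‖y‖) := by
          refine norm_integral_le_of_norm_le (hint _ (by fun_prop)) ?_
          filter_upwards [ae_restrict_mem measurableSet_closedBall] with y hy
          rw [norm_mul, Real.norm_of_nonneg (hq0 y hy)]
          have h2 := hW'.dist_le_mul (z - y) z
          rw [dist_eq_norm, dist_eq_norm, sub_sub_cancel_left, norm_neg] at h2
          calc ‖W' (z - y) - W' z‖ * polyEval q y ≤ κ' * ‖y‖ * polyEval q y := by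
                gcongr
                exact hq0 y hy
            _ = _ := by ring
      _ ≤ κ' * η := by
          rw [integral_const_mul]
          gcongr
      _ ≤ ε := hκη
  · have hball : ∀ y h, ‖y‖ ≤ 1 → h ∈ Icc (0 : ℝ) 1 → ‖z - y + h • v‖ ≤ R + 1 + M := by
      intro y h hy hh
      have h1 : ‖h • v‖ ≤ 1 * M := by
        rw [norm_smul, Real.norm_of_nonneg hh.1]
        exact mul_le_mul hh.2 hv (norm_nonneg _) zero_le_one
      linarith [norm_add_le (z - y) (h • v), _root_.norm_sub_le z y]
    have hyp' : ∀ y, ∀ h ∈ Icc (0 : ℝ) 1,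
        -(h * (b + D' * ‖y‖)) - D * h ^ 2 ≤ W' (z + h • v - y) - W' (z - y) := by
      intro y h hh
      rw [add_sub_right_comm]
      rcases le_total ‖y‖ 1 with hy | hy
      · have h1 := hball y h hy hh
        have h2 := hball y 0 hy ⟨le_rfl, zero_le_one⟩
        rw [zero_smul, add_zero] at h2
        rw [hWW' _ h1, hWW' _ h2]
        have h3 : 0 ≤ h * ((κ' * M + M) * ‖y‖) :=
          mul_nonneg hh.1 (by positivity)
        have := hyp y hy h hh
        simp only [D']
        linarith
      · have h1 := hW'.dist_le_mul (z - y + h • v) (z - y)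
        rw [Real.dist_eq, dist_eq_norm, add_sub_cancel_left, norm_smul,
          Real.norm_of_nonneg hh.1] at h1
        have h2 : κ' * (h * ‖v‖) ≤ κ' * (h * M) := by
          have := hh.1
          gcongr
        have h3 : 0 ≤ D * h ^ 2 := by positivity
        have h4 : h * (-M + (κ' * M + M)) ≤ h * (b + D' * ‖y‖) := by
          refine mul_le_mul_of_nonneg_left ?_ hh.1
          have h5 : κ' * M + M ≤ D' := by simp only [D']; linarith
          have h6 : D' * 1 ≤ D' * ‖y‖ := by gcongr
          linarith [neg_le_of_abs_le hb]
        linarith [neg_le_of_abs_le h1]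
    -- Average `hyp'` against the kernel, which has mass 1 and first moment at most `η`. Dividing by
    -- `h` and letting `h` tend to 0 then removes the quadratic term.
    have hstep : ∀ h ∈ Icc (0 : ℝ) 1,
        -(h * (b + ε)) - D * h ^ 2 ≤ polyEval J (z + h • v) - polyEval J z := by
      intro h hh
      have hzv : ‖z + h • v‖ ≤ R + M := by
        have h1 : ‖h • v‖ ≤ 1 * M := by
          rw [norm_smul, Real.norm_of_nonneg hh.1]
          exact mul_le_mul hh.2 hv (norm_nonneg _) zero_le_one
        linarith [norm_add_le z (h • v)]
      have hc := hW'.continuous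
      rw [hJs _ hzv, hJs z (by linarith),
        ← integral_sub (hint _ (by fun_prop)) (hint _ (by fun_prop))]
      calc -(h * (b + ε)) - D * h ^ 2
          ≤ (-(h * b) - D * h ^ 2) * (∫ y in s, polyEval q y)
            + -(h * D') * ∫ y in s, polyEval q y * ‖y‖ := by
            rw [hq1]
            have h1 : D' * ∫ y in s, polyEval q y * ‖y‖ ≤ ε :=
              (mul_le_mul_of_nonneg_left hqη (by positivity)).trans hDη
            have := mul_le_mul_of_nonneg_left h1 hh.1
            linarith
        _ = ∫ y in s, ((-(h * b) - D * h ^ 2) * polyEval q y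
              + -(h * D') * (polyEval q y * ‖y‖)) := by
            rw [integral_add (hint _ (by fun_prop)) (hint _ (by fun_prop)), integral_const_mul,
              integral_const_mul]
        _ ≤ _ := by
            refine setIntegral_mono_on (hint _ (by fun_prop)) (hint _ (by fun_prop))
              measurableSet_closedBall fun y hy => ?_
            have := mul_le_mul_of_nonneg_right (hyp' y h hh) (hq0 y hy)
            linarith
    have hder := hasDerivAt_polyEval_line J z v
    have h1 := (hder.tendsto_slope_zero_right).add
      ((tendsto_nhdsWithin_of_tendsto_nhds (s := Ioi 0)
        (Continuous.tendsto (f := fun h : ℝ => b + ε + D * h) (by fun_prop) 0)))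
    have h2 := ge_of_tendsto (b := 0) h1 (by
      filter_upwards [Ioc_mem_nhdsGT (zero_lt_one' ℝ)] with h hh
      have h3 := hstep h ⟨hh.1.le, hh.2⟩
      rw [zero_add, zero_smul, add_zero, smul_eq_mul]
      have h4 : 0 ≤ h⁻¹ * (polyEval J (z + h • v) - polyEval J z + (h * (b + ε) + D * h ^ 2)) :=
        mul_nonneg (inv_nonneg.2 hh.1.le) (by linarith)
      have h5 : h⁻¹ * (h * (b + ε) + D * h ^ 2) = b + ε + D * h := by
        have := hh.1.ne'
        field_simp
      rwa [mul_add, h5] at h4)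
    simp only [map_sub, pderiv_C, sub_zero]
    linarith

end Polynomials

/-! ### Trajectories, reachability and the lower bound by feasible polynomials. -/

section Trajectories

variable {n m : ℕ}

/-- Both trajectories have compact range, so a local Lipschitz bound suffices for Grönwall.
Uniqueness in `IsAdmissible` is thus automatic when `f` is locally Lipschitz on the whole space
times `U`. -/
theorem IsTrajectory.eqOn {Ω Ω' : Set (EuclideanSpace ℝ (Fin n))}
    {U : Set (EuclideanSpace ℝ (Fin m))}
    {f : EuclideanSpace ℝ (Fin n) × EuclideanSpace ℝ (Fin m) → EuclideanSpace ℝ (Fin n)}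
    {T t₀ : ℝ} {x₀ : EuclideanSpace ℝ (Fin n)} {u : ℝ → EuclideanSpace ℝ (Fin m)}
    {φ ψ : ℝ → EuclideanSpace ℝ (Fin n)} (hf : LocLip f (univ ×ˢ U)) (hU : IsCompact U)
    (hu : ∀ t ∈ Icc t₀ T, u t ∈ U) (hφ : IsTrajectory Ω f T x₀ t₀ u φ)
    (hψ : IsTrajectory Ω' f T x₀ t₀ u ψ) : EqOn ψ φ (Icc t₀ T) := by
  obtain ⟨K, hK⟩ := hf ((φ '' Icc t₀ T ∪ ψ '' Icc t₀ T) ×ˢ U) (prod_mono (subset_univ _) le_rfl)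
    (((isCompact_Icc.image_of_continuousOn hφ.1).union
      (isCompact_Icc.image_of_continuousOn hψ.1)).prod hU)
  intro t ht
  have := norm_sub_le_of_integral_eq K.2 hψ.1 hφ.1 hψ.2.1 hφ.2.1 hψ.2.2.1 hφ.2.2.1
    (fun s hs => by
      have := hK.dist_le_mul (ψ s, u s) ⟨Or.inr (mem_image_of_mem ψ hs), hu s hs⟩ (φ s, u s)
        ⟨Or.inl (mem_image_of_mem φ hs), hu s hs⟩
      rw [dist_eq_norm, dist_eq_norm] at this
      simpa [Prod.norm_def] using this) t ht
  rw [sub_self, norm_zero, zero_mul] at this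
  exact sub_eq_zero.1 (norm_le_zero_iff.1 this)

/-- The field is autonomous, so a trajectory may be delayed to start at any time `t`. -/
theorem IsControlled.isTrajectory_shift {Ω : Set (EuclideanSpace ℝ (Fin n))}
    {U : Set (EuclideanSpace ℝ (Fin m))}
    {f f' : EuclideanSpace ℝ (Fin n) × EuclideanSpace ℝ (Fin m) → EuclideanSpace ℝ (Fin n)}
    {K L S t : ℝ} {x : EuclideanSpace ℝ (Fin n)} {u : ℝ → EuclideanSpace ℝ (Fin m)}
    {φ : ℝ → EuclideanSpace ℝ (Fin n)} (h : IsControlled f' U L x u φ) (hf' : BddLip K f')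
    (hL : S - t ≤ L) (hΩ : ∀ s ∈ Icc 0 (S - t), φ s ∈ Ω)
    (hff' : ∀ s ∈ Icc 0 (S - t), f (φ s, u s) = f' (φ s, u s)) :
    IsTrajectory Ω f S x t (fun s => u (s - t)) (fun s => φ (s - t)) := by
  have hsub : ∀ {s}, s ∈ Icc t S → s - t ∈ Icc 0 (S - t) := fun {s} hs =>
    ⟨by linarith [hs.1], by linarith [hs.2]⟩
  refine ⟨(h.continuous.comp (continuous_id.sub continuous_const)).continuousOn, ?_, ?_,
    fun s hs => hΩ _ (hsub hs)⟩
  · rcases lt_or_ge S t with hSt | htS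
    · simp [Icc_eq_empty_of_lt hSt]
    · have h1 := (intervalIntegrable_iff_integrableOn_Icc_of_le htS).1
        (hf'.intervalIntegrable_field (u := fun s => u (s - t)) (φ := fun s => φ (s - t))
          (h.measurable.comp (measurable_id.sub_const t))
          (h.continuous.comp (continuous_id.sub continuous_const)) t S)
      exact h1.congr_fun (fun s hs => (hff' _ (hsub hs)).symm) measurableSet_Icc
  · intro r hr
    change φ (r - t) = x + ∫ s in t..r, f (φ (s - t), u (s - t))
    rw [h.eq_integral _ ⟨(hsub hr).1, (hsub hr).2.trans hL⟩,
      intervalIntegral.integral_comp_sub_right (fun s => f (φ s, u s)) t, sub_self]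
    congr 1
    refine intervalIntegral.integral_congr fun s hs => ?_
    rw [uIcc_of_le (hsub hr).1] at hs
    exact (hff' s ⟨hs.1, hs.2.trans (hsub hr).2⟩).symm

/-- Trajectories of a field that agrees with `f` near `Ω` inherit the reachable-set condition. -/
theorem IsControlled.mem_of_forwardReachable_subset {Λ Ω : Set (EuclideanSpace ℝ (Fin n))}
    {U : Set (EuclideanSpace ℝ (Fin m))}
    {f f' : EuclideanSpace ℝ (Fin n) × EuclideanSpace ℝ (Fin m) → EuclideanSpace ℝ (Fin n)}
    {K L R T : ℝ} {x : EuclideanSpace ℝ (Fin n)} {u : ℝ → EuclideanSpace ℝ (Fin m)}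
    {φ : ℝ → EuclideanSpace ℝ (Fin n)} (hf : LocLip f (univ ×ˢ U)) (hU : IsCompact U)
    (hf' : BddLip K f') (hff' : EqOn f' f (Metric.closedBall 0 (R + 1) ×ˢ U))
    (hΩ : Ω ⊆ Metric.closedBall 0 R) (hreach : forwardReachable f Λ univ U (Icc 0 T) ⊆ Ω)
    (hTL : T ≤ L) (hx : x ∈ Λ) (hxΩ : x ∈ Ω) (h : IsControlled f' U L x u φ) :
    ∀ S ∈ Icc 0 T, φ S ∈ Ω := by
  have hK := hf'.nonneg
  have hball : ∀ S ∈ Icc 0 T, (∀ s ∈ Icc 0 S, φ s ∈ Metric.closedBall 0 (R + 1)) → φ S ∈ Ω := by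
    intro S hS hs
    have hff : ∀ s ∈ Icc 0 (S - 0), f (φ s, u s) = f' (φ s, u s) := fun s hs' =>
      (hff' (mk_mem_prod (hs s (by rwa [sub_zero] at hs')) (h.mem s))).symm
    have htraj := h.isTrajectory_shift (Ω := univ) (f := f) (S := S) (t := 0) hf'
      (by linarith [hS.2]) (fun _ _ => mem_univ _) hff
    simp only [sub_zero] at htraj
    have hadm : IsAdmissible univ U f S x 0 u :=
      ⟨h.measurable.aemeasurable, fun s _ => h.mem s, φ, htraj,
        fun ψ hψ => htraj.eqOn hf hU (fun s _ => h.mem s) hψ⟩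
    have hmem : φ S ∈ forwardReachable f Λ univ U (Icc 0 T) :=
      ⟨x, hx, S, hS, u, φ, hadm, htraj, rfl⟩
    exact hreach hmem
  -- Continuation in steps of length `1/(K + 1)`: at speed at most `K`, a trajectory in `Ω` cannot
  -- leave the ball of radius `R + 1`, where the fields agree, within one step.
  have key : ∀ k : ℕ, ∀ S ∈ Icc 0 T, S ≤ k * (K + 1)⁻¹ → φ S ∈ Ω := by
    intro k
    induction k with
    | zero =>
      intro S hS hS0
      have : S = 0 := le_antisymm (by simpa using hS0) hS.1
      rwa [this, h.apply_zero (hS.1.trans (hS.2.trans hTL))]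
    | succ k ih =>
      intro S hS hSk
      refine hball S hS fun s hs => ?_
      have hinv : 0 < (K + 1)⁻¹ := by positivity
      have hk : 0 ≤ (k : ℝ) * (K + 1)⁻¹ := by positivity
      push_cast at hSk
      set s' := min s (k * (K + 1)⁻¹)
      have hs's : s' ≤ s := min_le_left _ _
      have hs'0 : 0 ≤ s' := le_min hs.1 hk
      have hsT := hs.2.trans hS.2
      have h1 : ‖φ s'‖ ≤ R := by
        simpa using hΩ (ih s' ⟨hs'0, hs's.trans hsT⟩ (min_le_right _ _))
      have h2 : s - s' ≤ (K + 1)⁻¹ := by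
        rcases min_choice s (k * (K + 1)⁻¹) with h' | h'
        · rw [show s' = s from h', sub_self]
          exact hinv.le
        · rw [show s' = k * (K + 1)⁻¹ from h']
          linarith [hs.2]
      have h3 : ‖φ s - φ s'‖ ≤ 1 := by
        refine (h.norm_sub_le hf' ⟨hs'0, hs's.trans (hsT.trans hTL)⟩
          ⟨hs.1, hsT.trans hTL⟩).trans ?_
        rw [abs_of_nonneg (sub_nonneg.2 hs's)]
        calc K * (s - s') ≤ (K + 1) * (K + 1)⁻¹ := by gcongr; linarith
          _ = 1 := mul_inv_cancel₀ (by positivity)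
      rw [mem_closedBall_zero_iff]
      linarith [norm_sub_norm_le (φ s) (φ s')]
  intro S hS
  obtain ⟨k, hk⟩ := exists_nat_ge (S * (K + 1))
  refine key k S hS ?_
  rw [← div_eq_mul_inv, le_div_iff₀ (by positivity)]
  exact hk

/-- A feasible polynomial is a lower bound for the cost of every trajectory. -/
theorem OCP.IsFeasible.polyEval_le_cost {P : OCP n m} {d : ℕ}
    {J : MvPolynomial (Option (Fin n)) ℝ} (hJ : P.IsFeasible d J) {K : ℝ}
    {c' : EuclideanSpace ℝ (Fin n) × EuclideanSpace ℝ (Fin m) × ℝ → ℝ} (hc' : BddLip K c')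
    (hcc' : EqOn c' P.c (P.Ω ×ˢ (P.U ×ˢ Icc 0 P.T))) {x : EuclideanSpace ℝ (Fin n)} {t : ℝ}
    (ht : t ∈ Icc 0 P.T) {u : ℝ → EuclideanSpace ℝ (Fin m)} {φ : ℝ → EuclideanSpace ℝ (Fin n)}
    (hum : AEMeasurable u (volume.restrict (Icc t P.T))) (huU : ∀ s ∈ Icc t P.T, u s ∈ P.U)
    (hφ : IsTrajectory P.Ω P.f P.T x t u φ) :
    polyEval J (x, t) ≤ (∫ s in t..P.T, P.c (φ s, u s, s)) + P.g (φ P.T) := by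
  obtain ⟨hφc, hφi, hφe, hφΩ⟩ := hφ
  have htT := ht.2
  have hfi : IntervalIntegrable (fun s => P.f (φ s, u s)) volume t P.T :=
    (intervalIntegrable_iff_integrableOn_Icc_of_le htT).2 hφi
  have hfi' : ∀ i, IntervalIntegrable (fun s => P.f (φ s, u s) i) volume t P.T := fun i =>
    ⟨(EuclideanSpace.proj (𝕜 := ℝ) i).integrable_comp hfi.1,
      (EuclideanSpace.proj (𝕜 := ℝ) i).integrable_comp hfi.2⟩
  -- Measurability comes from the continuous extension `c'`; `P.c` itself is unrestricted off the
  -- constraint set.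
  have hci : IntervalIntegrable (fun s => P.c (φ s, u s, s)) volume t P.T := by
    rw [intervalIntegrable_iff_integrableOn_Icc_of_le htT]
    have h1 : IntegrableOn (fun s => c' (φ s, u s, s)) (Icc t P.T) := by
      refine (integrable_const K).mono' ?_ (ae_of_all _ fun s => hc'.bound _)
      exact (hc'.continuous.measurable.comp_aemeasurable
        ((hφc.aemeasurable measurableSet_Icc).prodMk (hum.prodMk aemeasurable_id))
        ).aestronglyMeasurable
    exact h1.congr_fun (fun s hs => hcc' ⟨hφΩ s hs, huU s hs, ht.1.trans hs.1, hs.2⟩)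
      measurableSet_Icc
  -- The integral formula also makes sense outside `[t, T]`, so its coordinates have two-sided
  -- derivatives almost everywhere, whatever `φ` does there.
  set γ : ℝ → Option (Fin n) → ℝ := fun s o =>
    o.elim s (fun i => x i + ∫ r in t..s, P.f (φ r, u r) i) with hγ
  have hγφ : ∀ s ∈ Icc t P.T, ∀ p : MvPolynomial (Option (Fin n)) ℝ,
      MvPolynomial.eval (γ s) p = polyEval p (φ s, s) := by
    intro s hs p
    unfold polyEval
    congr 2
    funext o
    cases o with
    | none => rfl
    | some i =>
      have h1 := (EuclideanSpace.proj (𝕜 := ℝ) i : EuclideanSpace ℝ (Fin n) →L[ℝ] ℝ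
        ).intervalIntegral_comp_comm (hfi.mono_set (by
          rw [uIcc_of_le hs.1, uIcc_of_le htT]
          exact Icc_subset_Icc_right hs.2))
      simp only [hγ, Option.elim, hφe s hs]
      simpa using h1
  have hac : AbsolutelyContinuousOnInterval (fun s => MvPolynomial.eval (γ s) J) t P.T := by
    refine J.absolutelyContinuousOnInterval_eval fun o => ?_
    cases o with
    | none => exact (LipschitzWith.id.lipschitzOnWith (s := uIcc t P.T)).absolutelyContinuousOnInterval
    | some i =>
      exact ((LipschitzWith.const (x i)).lipschitzOnWith.absolutelyContinuousOnInterval).fun_add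
        ((hfi' i).absolutelyContinuousOnInterval_intervalIntegral (c := t) (by simp))
  have hder : ∀ᵐ s ∂volume.restrict (Icc t P.T),
      -P.c (φ s, u s, s) ≤ deriv (fun s => MvPolynomial.eval (γ s) J) s := by
    rw [ae_restrict_iff' measurableSet_Icc]
    have hall : ∀ᵐ s : ℝ, ∀ i, s ∈ uIcc t P.T →
        HasDerivAt (fun s => ∫ r in t..s, P.f (φ r, u r) i) (P.f (φ s, u s) i) s := by
      rw [ae_all_iff]
      intro i
      filter_upwards [(hfi' i).ae_hasDerivAt_integral] with s hs hs'
      exact hs hs' t (by simp)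
    filter_upwards [hall, Measure.ae_ne volume t, Measure.ae_ne volume P.T] with s hs hst hsT hsI
    have h1 := J.hasDerivAt_eval (γ := γ) (s := s)
      (γ' := fun o => o.elim 1 (fun i => P.f (φ s, u s) i)) fun o => by
        cases o with
        | none => exact hasDerivAt_id s
        | some i => exact (hs i (by rwa [uIcc_of_le htT])).const_add (x i)
    rw [h1.deriv, Fintype.sum_option]
    have h2 := hJ.2.1 (φ s) (hφΩ s hsI) s
      ⟨ht.1.trans_lt (lt_of_le_of_ne hsI.1 hst.symm), lt_of_le_of_ne hsI.2 hsT⟩ (u s) (huU s hsI)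
    simp only [hγφ s hsI, Option.elim]
    linarith
  have h1 := intervalIntegral.integral_mono_ae_restrict htT hci.neg hac.intervalIntegrable_deriv hder
  have h2 := hJ.2.2 (φ P.T) (hφΩ P.T ⟨htT, le_rfl⟩)
  have h3 : φ t = x := by simpa using hφe t ⟨le_rfl, htT⟩
  rw [hac.integral_deriv_eq_sub, hγφ _ ⟨htT, le_rfl⟩, hγφ _ ⟨le_rfl, htT⟩, h3] at h1
  have h4 : ∫ s in t..P.T, (-fun s => P.c (φ s, u s, s)) s
      = -∫ s in t..P.T, P.c (φ s, u s, s) := by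
    simp [intervalIntegral.integral_neg]
  linarith

end Trajectories

/-! ### Feasible polynomials and the identification of the value function. -/

namespace OCP

variable {n m : ℕ}

/-- Bounded globally Lipschitz data that agree with those of `P` where `P` constrains them; the
field agrees on a neighbourhood of the state constraint set. -/
structure IsExtension (P : OCP n m) (K R : ℝ)
    (f : EuclideanSpace ℝ (Fin n) × EuclideanSpace ℝ (Fin m) → EuclideanSpace ℝ (Fin n))
    (c : EuclideanSpace ℝ (Fin n) × EuclideanSpace ℝ (Fin m) × ℝ → ℝ)
    (g : EuclideanSpace ℝ (Fin n) → ℝ) : Prop where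
  bddLip_f : BddLip K f
  bddLip_c : BddLip K c
  bddLip_g : BddLip K g
  nonneg : 0 ≤ R
  subset : P.Ω ⊆ Metric.closedBall 0 R
  eqOn_f : EqOn f P.f (Metric.closedBall 0 (R + 1) ×ˢ P.U)
  eqOn_c : EqOn c P.c (P.Ω ×ˢ (P.U ×ˢ Icc 0 P.T))
  eqOn_g : EqOn g P.g P.Ω

theorem IsLipschitz.exists_isExtension {P : OCP n m} (hP : P.IsLipschitz) (hΩ : IsCompact P.Ω)
    (hf : LocLip P.f (univ ×ˢ P.U)) : ∃ K R f c g, P.IsExtension K R f c g := by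
  obtain ⟨R, hR⟩ := hΩ.isBounded.subset_closedBall 0
  have hR' : P.Ω ⊆ Metric.closedBall 0 (max 0 R) :=
    hR.trans (Metric.closedBall_subset_closedBall (le_max_right _ _))
  have hcf : IsCompact (Metric.closedBall (0 : EuclideanSpace ℝ (Fin n)) (max 0 R + 1) ×ˢ P.U) :=
    (isCompact_closedBall _ _).prod hP.isCompact_U
  have hcc : IsCompact (P.Ω ×ˢ (P.U ×ˢ Icc 0 P.T)) := hΩ.prod (hP.isCompact_U.prod isCompact_Icc)
  obtain ⟨Cf, hCf⟩ := hf _ (prod_mono (subset_univ _) le_rfl) hcf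
  obtain ⟨Cc, hCc⟩ := hP.locLip_c _ le_rfl hcc
  obtain ⟨Cg, hCg⟩ := hP.locLip_g _ le_rfl hΩ
  obtain ⟨Kf, f, hf₁, hf₂⟩ := hCf.exists_bddLip_extension_euclidean hcf
  obtain ⟨Kc, c, hc₁, hc₂⟩ := hCc.exists_bddLip_extension hcc
  obtain ⟨Kg, g, hg₁, hg₂⟩ := hCg.exists_bddLip_extension hΩ
  exact ⟨max Kf (max Kc Kg), max 0 R, f, c, g, hf₁.mono (le_max_left _ _),
    hc₁.mono ((le_max_left _ _).trans (le_max_right _ _)),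
    hg₁.mono ((le_max_right _ _).trans (le_max_right _ _)), le_max_left _ _, hR', hf₂, hc₂, hg₂⟩

theorem IsFeasible.mono {P : OCP n m} {d d' : ℕ} {J : MvPolynomial (Option (Fin n)) ℝ}
    (hJ : P.IsFeasible d J) (h : d ≤ d') : P.IsFeasible d' J :=
  ⟨hJ.1.trans h, hJ.2⟩

namespace IsExtension

variable {P : OCP n m} {K R : ℝ}
  {f : EuclideanSpace ℝ (Fin n) × EuclideanSpace ℝ (Fin m) → EuclideanSpace ℝ (Fin n)}
  {c : EuclideanSpace ℝ (Fin n) × EuclideanSpace ℝ (Fin m) × ℝ → ℝ}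
  {g : EuclideanSpace ℝ (Fin n) → ℝ}

/-- Affine functions of time that decrease steeply enough are feasible. -/
theorem exists_isFeasible_one (e : P.IsExtension K R f c g) : ∃ J, P.IsFeasible 1 J := by
  -- The time derivative `K + 1` beats `c ≥ -K`, and the terminal value `-(K + 1)` is below `g ≥
  -- -K`.
  refine ⟨MvPolynomial.C (K + 1) * (MvPolynomial.X none - MvPolynomial.C P.T)
    - MvPolynomial.C (K + 1), ?_, fun x hx t ht u hu => ?_, fun x hx => ?_⟩
  · refine (MvPolynomial.totalDegree_sub _ _).trans (max_le ?_
      ((MvPolynomial.totalDegree_C _).trans_le zero_le_one))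
    refine (MvPolynomial.totalDegree_mul _ _).trans ?_
    rw [MvPolynomial.totalDegree_C, zero_add]
    exact (MvPolynomial.totalDegree_sub _ _).trans
      (max_le (MvPolynomial.totalDegree_X _).le (by simp))
  · have h1 := neg_le_of_abs_le (e.bddLip_c.bound (x, u, t))
    rw [e.eqOn_c ⟨hx, hu, Ioo_subset_Icc_self ht⟩] at h1
    simp only [polyEval, Derivation.leibniz, map_sub, MvPolynomial.pderiv_C,
      MvPolynomial.pderiv_X]
    simp
    linarith
  · have h1 := neg_le_of_abs_le (e.bddLip_g.bound x)
    rw [e.eqOn_g hx] at h1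
    simp [polyEval]
    linarith

/-- Feasible polynomials come arbitrarily close to the unconstrained value function from below. -/
theorem exists_isFeasible_ge (e : P.IsExtension K R f c g) (hU : P.U.Nonempty) (hT : 0 ≤ P.T)
    {ε : ℝ} (hε : 0 < ε) :
    ∃ J, P.IsFeasible J.totalDegree J ∧ ∀ x ∈ P.Ω, ∀ t ∈ Icc 0 P.T,
      extendedValue f c g P.U K P.T (P.T + 1) (x, t) - ε ≤ polyEval J (x, t) := by
  have hK := e.bddLip_f.nonneg
  have hR := e.nonneg
  have hL : 0 ≤ P.T + 1 := by linarith
  obtain ⟨κ, hκ⟩ := lipschitzWith_extendedValue (T := P.T) e.bddLip_f e.bddLip_c e.bddLip_g hL hU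
  obtain ⟨D, hD, htr⟩ := exists_extendedValue_translate_ge (T := P.T) e.bddLip_f e.bddLip_c
    e.bddLip_g hL hU
  set W := extendedValue f c g P.U K P.T (P.T + 1)
  -- The error budget is `δ` for the approximation, `2 * δ` for the shift that gives the strict
  -- terminal inequality, and at most `2 * δ * P.T` for the tilt that gives strict dissipation.
  set δ := ε / (3 + 2 * P.T)
  have hδ : 0 < δ := by positivity
  have hδε : δ * (3 + 2 * P.T) = ε := div_mul_cancel₀ _ (by positivity)
  obtain ⟨J₀, hJ₀, hJ₀'⟩ := hκ.exists_polyEval_approx (R := R + P.T) (M := K + 1)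
    (by positivity) (by positivity) hD hδ
  have hnorm : ∀ x ∈ P.Ω, ∀ t ∈ Icc 0 P.T, ‖(x, t)‖ ≤ R + P.T := fun x hx t ht => by
    have h1 := mem_closedBall_zero_iff.1 (e.subset hx)
    rw [Prod.norm_mk, Real.norm_of_nonneg ht.1]
    exact max_le (by linarith) (by linarith [ht.2])
  set J := J₀ - MvPolynomial.C (2 * δ)
    + MvPolynomial.C (2 * δ) * (MvPolynomial.X none - MvPolynomial.C P.T)
  have hJ : ∀ x t, polyEval J (x, t) = polyEval J₀ (x, t) - 2 * δ + 2 * δ * (t - P.T) :=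
    fun x t => by simp [J, polyEval]
  have hJt : ∀ z, polyEval (MvPolynomial.pderiv none J) z
      = polyEval (MvPolynomial.pderiv none J₀) z + 2 * δ := fun z => by
    simp only [J, polyEval, Derivation.leibniz, map_sub, map_add, MvPolynomial.pderiv_C,
      MvPolynomial.pderiv_X]
    simp
  have hJx : ∀ i z, polyEval (MvPolynomial.pderiv (some i) J) z
      = polyEval (MvPolynomial.pderiv (some i) J₀) z := fun i z => by
    simp only [J, polyEval, Derivation.leibniz, map_sub, map_add, MvPolynomial.pderiv_C,
      MvPolynomial.pderiv_X]
    simp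
  refine ⟨J, ⟨le_rfl, fun x hx t ht u hu => ?_, fun x hx => ?_⟩, fun x hx t ht => ?_⟩
  · have ht' := Ioo_subset_Icc_self ht
    have hfx : f (x, u) = P.f (x, u) :=
      e.eqOn_f (mk_mem_prod (Metric.closedBall_subset_closedBall (by linarith) (e.subset hx)) hu)
    have hcx : c (x, u, t) = P.c (x, u, t) := e.eqOn_c ⟨hx, hu, ht'⟩
    have h1 := hJ₀' (x, t) (f (x, u), 1) (c (x, u, t)) (hnorm x hx t ht')
      (by
        rw [Prod.norm_mk, norm_one]
        exact max_le (by linarith [e.bddLip_f.bound (x, u)]) (by linarith))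
      ((e.bddLip_c.bound (x, u, t)).trans (by linarith))
      -- The horizon `P.T + 1` is chosen for this: with `‖y‖ ≤ 1` the translated time is at least
      -- `-1`.
      (fun y hy h hh => by
        refine htr u hu (x, t) y ?_ h hh.1
        have h2 : y.2 ≤ 1 := (le_abs_self _).trans ((norm_snd_le y).trans hy)
        simp only
        linarith [ht.1])
    rw [hJt]
    simp only [hJx, ← hcx, ← hfx]
    simp only [mul_one] at h1
    linarith
  · have h1 := le_of_abs_le (hJ₀ (x, P.T) (hnorm x hx _ ⟨hT, le_rfl⟩))
    have h2 : W (x, P.T) = P.g x := by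
      simp only [W]
      rw [extendedValue_of_le e.bddLip_f e.bddLip_c e.bddLip_g hL hU x le_rfl, e.eqOn_g hx]
      simp
    rw [hJ]
    linarith
  · have h1 := neg_le_of_abs_le (hJ₀ (x, t) (hnorm x hx t ht))
    have h2 : 2 * δ * (-P.T) ≤ 2 * δ * (t - P.T) := by
      gcongr
      linarith [ht.1]
    rw [hJ]
    linarith

/-- Every unconstrained cost from a point of `Λ` is the cost of an admissible input. -/
theorem controlCost_mem_costs (e : P.IsExtension K R f c g) (hUc : IsCompact P.U)
    (hf : LocLip P.f (univ ×ˢ P.U)) {Λ : Set (EuclideanSpace ℝ (Fin n))} (hΛ : Λ ⊆ P.Ω)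
    (hreach : forwardReachable P.f Λ univ P.U (Icc 0 P.T) ⊆ P.Ω)
    {L : ℝ} (hTL : P.T ≤ L) {x : EuclideanSpace ℝ (Fin n)} (hx : x ∈ Λ) {t : ℝ}
    (ht : t ∈ Icc 0 P.T) {u : ℝ → EuclideanSpace ℝ (Fin m)} {φ : ℝ → EuclideanSpace ℝ (Fin n)}
    (h : IsControlled f P.U L x u φ) : controlCost c g P.T t u φ ∈ P.costs x t := by
  have hT' : ∀ s ∈ Icc 0 (P.T - t), s ∈ Icc 0 P.T := fun s hs =>
    ⟨hs.1, hs.2.trans (by linarith [ht.1])⟩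
  have htT : P.T - t ∈ Icc 0 (P.T - t) := ⟨by linarith [ht.2], le_rfl⟩
  have hφ : ∀ s ∈ Icc 0 (P.T - t), φ s ∈ P.Ω := fun s hs =>
    h.mem_of_forwardReachable_subset hf hUc e.bddLip_f e.eqOn_f e.subset hreach hTL hx (hΛ hx) s
      (hT' s hs)
  have hff : ∀ s ∈ Icc 0 (P.T - t), P.f (φ s, u s) = f (φ s, u s) := fun s hs =>
    (e.eqOn_f (mk_mem_prod (Metric.closedBall_subset_closedBall (by linarith)
      (e.subset (hφ s hs))) (h.mem s))).symm
  have htraj := h.isTrajectory_shift (t := t) (S := P.T) e.bddLip_f (by linarith [ht.1]) hφ hff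
  refine ⟨fun s => u (s - t), fun s => φ (s - t), ⟨(h.measurable.comp
    (measurable_id.sub_const t)).aemeasurable, fun s _ => h.mem _, _, htraj, fun ψ hψ =>
      htraj.eqOn hf hUc (fun s _ => h.mem _) hψ⟩, htraj, ?_⟩
  unfold controlCost
  rw [e.eqOn_g (hφ _ htT)]
  congr 1
  have h1 := intervalIntegral.integral_comp_sub_right (a := t) (b := P.T)
    (fun s => P.c (φ s, u s, t + s)) t
  simp only [add_sub_cancel, sub_self] at h1
  rw [h1]
  refine intervalIntegral.integral_congr fun s hs => ?_
  rw [uIcc_of_le htT.1] at hs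
  exact e.eqOn_c ⟨hφ s hs, h.mem s, by linarith [hs.1, ht.1], by linarith [hs.2]⟩

/-- A feasible polynomial is a lower bound for every value function. -/
theorem polyEval_le_value (e : P.IsExtension K R f c g)
    {V : EuclideanSpace ℝ (Fin n) × ℝ → EReal} (hV : P.IsValueFunction V) {d : ℕ}
    {J : MvPolynomial (Option (Fin n)) ℝ} (hJ : P.IsFeasible d J) {x : EuclideanSpace ℝ (Fin n)}
    (hx : x ∈ P.Ω) {t : ℝ} (ht : t ∈ Icc 0 P.T) : (polyEval J (x, t) : EReal) ≤ V (x, t) := by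
  rw [hV x hx t ht]
  refine le_iInf₂ fun r hr => ?_
  obtain ⟨u, φ, ⟨hum, huU, -⟩, hφ, rfl⟩ := hr
  exact EReal.coe_le_coe_iff.2 (hJ.polyEval_le_cost e.bddLip_c e.eqOn_c ht hum huU hφ)

/-- On `Λ × [0, T]` every value function is the unconstrained value function. -/
theorem value_eq (e : P.IsExtension K R f c g) (hUc : IsCompact P.U) (hU : P.U.Nonempty)
    (hT : 0 ≤ P.T) (hf : LocLip P.f (univ ×ˢ P.U)) {Λ : Set (EuclideanSpace ℝ (Fin n))}
    (hΛ : Λ ⊆ P.Ω) (hreach : forwardReachable P.f Λ univ P.U (Icc 0 P.T) ⊆ P.Ω)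
    {V : EuclideanSpace ℝ (Fin n) × ℝ → EReal} (hV : P.IsValueFunction V)
    {z : EuclideanSpace ℝ (Fin n) × ℝ} (hz : z ∈ Λ ×ˢ Icc 0 P.T) :
    V z = (extendedValue f c g P.U K P.T (P.T + 1) z : EReal) := by
  obtain ⟨x, t⟩ := z
  obtain ⟨hx, ht⟩ := hz
  simp only at hx ht
  have hL : 0 ≤ P.T + 1 := by linarith
  have hle : ∀ u φ, IsControlled f P.U (P.T + 1) x u φ →
      V (x, t) ≤ (controlCost c g P.T t u φ : EReal) := fun u φ h => by
    rw [hV x (hΛ hx) t ht]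
    exact iInf₂_le _ (e.controlCost_mem_costs hUc hf hΛ hreach (by linarith) hx ht h)
  obtain ⟨J₁, hJ₁⟩ := e.exists_isFeasible_one
  have hbot : V (x, t) ≠ ⊥ := fun h => by
    have h1 := e.polyEval_le_value hV hJ₁ (hΛ hx) ht
    rw [h, le_bot_iff] at h1
    exact EReal.coe_ne_bot _ h1
  have htop : V (x, t) ≠ ⊤ := fun h => by
    obtain ⟨u₀, hu₀⟩ := hU
    obtain ⟨φ, hφ⟩ := exists_isControlled (U := P.U) e.bddLip_f hL (measurable_const (a := u₀))
      (fun _ => hu₀) x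
    have h1 := hle _ φ hφ
    rw [h, top_le_iff] at h1
    exact EReal.coe_ne_top _ h1
  lift V (x, t) to ℝ using ⟨htop, hbot⟩ with r hr
  refine congrArg _ (le_antisymm ?_ (le_of_forall_pos_le_add fun ε hε => ?_))
  · rw [extendedValue_eq _ ⟨by linarith [ht.1], ht.2⟩]
    exact le_freeValue e.bddLip_f hL hU fun u φ h => EReal.coe_le_coe_iff.1 (hle u φ h)
  -- A polynomial squeezed between `W - ε` and `V` avoids any direct comparison of constrained and
  -- free trajectories.
  · obtain ⟨J, hJ, hJε⟩ := e.exists_isFeasible_ge hU hT hε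
    have h1 := e.polyEval_le_value hV hJ (hΛ hx) ht
    rw [← hr, EReal.coe_le_coe_iff] at h1
    linarith [hJε x (hΛ hx) t ht]

end IsExtension

end OCP

/-! ### Convergence in the weighted norm. -/

/-- An integrable function times a continuous function is integrable on bounded sets. -/
theorem MeasureTheory.IntegrableOn.mul_continuous_of_isBounded {α : Type*} [PseudoMetricSpace α]
    [ProperSpace α] [MeasurableSpace α] [OpensMeasurableSpace α] {μ : Measure α} {w h : α → ℝ}
    {s : Set α} (hw : IntegrableOn w s μ) (hh : Continuous h) (hs : Bornology.IsBounded s)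
    (hsm : MeasurableSet s) : IntegrableOn (fun z => w z * h z) s μ := by
  obtain ⟨M, hM⟩ := hs.isCompact_closure.exists_bound_of_continuousOn hh.continuousOn
  refine Integrable.mul_bdd hw hh.aestronglyMeasurable (c := M) ?_
  filter_upwards [ae_restrict_mem hsm] with z hz
  exact hM z (subset_closure hz)

theorem mainTheorem5 {n m : ℕ} (P : OCP n m) (hP : P.IsLipschitz)
    (hΩ : IsCompact P.Ω) (hU : P.U.Nonempty) (hT : 0 ≤ P.T)
    (hf : LocLip P.f (univ ×ˢ P.U))
    (Λ : Set (EuclideanSpace ℝ (Fin n))) (hΛ : Λ ⊆ P.Ω) (hΛm : MeasurableSet Λ)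
    (hreach : forwardReachable P.f Λ univ P.U (Icc 0 P.T) ⊆ P.Ω)
    (w : EuclideanSpace ℝ (Fin n) × ℝ → ℝ)
    (hw : IntegrableOn w (Λ ×ˢ Icc 0 P.T)) (hw0 : ∀ z ∈ Λ ×ˢ Icc 0 P.T, 0 ≤ w z)
    (V : EuclideanSpace ℝ (Fin n) × ℝ → EReal) (hV : P.IsValueFunction V) :
    (∀ z ∈ Λ ×ˢ Icc 0 P.T, V z ≠ ⊤ ∧ V z ≠ ⊥) ∧
    (∀ J : MvPolynomial (Option (Fin n)) ℝ,
      IntegrableOn (fun z => w z * |(V z).toReal - polyEval J z|) (Λ ×ˢ Icc 0 P.T)) ∧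
    (∀ d : ℕ, 1 ≤ d → (∃ J, P.IsFeasible d J) ∧
      BddAbove {r | ∃ J, P.IsFeasible d J ∧ r = P.objective Λ w J}) ∧
    (∀ J : ℕ → MvPolynomial (Option (Fin n)) ℝ,
      (∀ᶠ d in atTop, P.IsSolution Λ w d (J d)) →
      Tendsto (fun d => ∫ z in Λ ×ˢ Icc 0 P.T, w z * |(V z).toReal - polyEval (J d) z|)
        atTop (𝓝 0)) ∧
    (∀ (ε : ℕ → ℝ) (J : ℕ → MvPolynomial (Option (Fin n)) ℝ), Tendsto ε atTop (𝓝 0) →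
      (∀ᶠ d in atTop, P.IsApproxSolution Λ w d (ε d) (J d)) →
      Tendsto (fun d => ∫ z in Λ ×ˢ Icc 0 P.T, w z * |(V z).toReal - polyEval (J d) z|)
        atTop (𝓝 0)) := by
  obtain ⟨K, R, f, c, g, e⟩ := hP.exists_isExtension hΩ hf
  have hVW := fun z hz => e.value_eq hP.isCompact_U hU hT hf hΛ hreach hV (z := z) hz
  obtain ⟨κ, hκ⟩ := lipschitzWith_extendedValue (T := P.T) (L := P.T + 1) e.bddLip_f e.bddLip_c
    e.bddLip_g (by linarith) hU
  set W := extendedValue f c g P.U K P.T (P.T + 1)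
  set S := Λ ×ˢ Icc 0 P.T
  have hSm : MeasurableSet S := hΛm.prod measurableSet_Icc
  have hSb : Bornology.IsBounded S :=
    (hΩ.isBounded.subset hΛ).prod (Metric.isBounded_Icc 0 P.T)
  have hWc : Continuous W := hκ.continuous
  have hint : ∀ h : EuclideanSpace ℝ (Fin n) × ℝ → ℝ, Continuous h →
      IntegrableOn (fun z => w z * h z) S := fun h hh => hw.mul_continuous_of_isBounded hh hSb hSm
  have hJW : ∀ d J, P.IsFeasible d J → ∀ z ∈ S, polyEval J z ≤ W z := fun d J hJ z hz => by
    have h1 := e.polyEval_le_value hV hJ (hΛ hz.1) hz.2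
    rwa [hVW z hz, EReal.coe_le_coe_iff] at h1
  have hdist : ∀ d J, P.IsFeasible d J → ∫ z in S, w z * |(V z).toReal - polyEval J z|
      = (∫ z in S, w z * W z) - P.objective Λ w J := fun d J hJ => by
    unfold OCP.objective
    rw [← integral_sub (hint W hWc) (hint _ (continuous_polyEval J))]
    refine setIntegral_congr_fun hSm fun z hz => ?_
    rw [hVW z hz, EReal.toReal_coe, abs_of_nonneg (sub_nonneg.2 (hJW d J hJ z hz)), mul_sub]
  have happrox : ∀ (ε : ℕ → ℝ) (J : ℕ → MvPolynomial (Option (Fin n)) ℝ), Tendsto ε atTop (𝓝 0) →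
      (∀ᶠ d in atTop, P.IsApproxSolution Λ w d (ε d) (J d)) →
      Tendsto (fun d => ∫ z in S, w z * |(V z).toReal - polyEval (J d) z|) atTop (𝓝 0) := by
    intro ε J hε hJ
    have hwI : 0 ≤ ∫ z in S, w z := setIntegral_nonneg hSm hw0
    rw [Metric.tendsto_nhds]
    intro η hη
    -- Half of `η` goes to the competitor `Q`, half to the tolerance; the `+ 1` allows for a weight
    -- of zero mass.
    set δ := η / 2 / ((∫ z in S, w z) + 1)
    have hδ : 0 < δ := by positivity
    have hδη : δ * ((∫ z in S, w z) + 1) = η / 2 := div_mul_cancel₀ _ (by positivity)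
    obtain ⟨Q, hQ, hQδ⟩ := e.exists_isFeasible_ge hU hT hδ
    filter_upwards [hJ, hε.eventually (gt_mem_nhds (half_pos hη)),
      eventually_ge_atTop Q.totalDegree] with d hd hεd hQd
    have h1 := hd.2 Q (hQ.mono hQd)
    have h2 : (∫ z in S, w z * W z) - δ * ∫ z in S, w z ≤ P.objective Λ w Q := by
      unfold OCP.objective
      rw [← integral_const_mul, ← integral_sub (hint W hWc) (hw.const_mul δ)]
      refine setIntegral_mono_on ((hint W hWc).sub (hw.const_mul δ))
        (hint _ (continuous_polyEval Q)) hSm fun z hz => ?_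
      have := mul_le_mul_of_nonneg_left (hQδ z.1 (hΛ hz.1) z.2 hz.2) (hw0 z hz)
      rw [mul_sub, mul_comm (w z) δ] at this
      exact this
    rw [Real.dist_eq, sub_zero, abs_of_nonneg (setIntegral_nonneg hSm fun z hz =>
      mul_nonneg (hw0 z hz) (abs_nonneg _)), hdist d _ hd.1]
    linarith
  refine ⟨fun z hz => ?_, fun J => ?_, fun d hd => ⟨?_, ?_⟩, fun J hJ => ?_, happrox⟩
  · rw [hVW z hz]
    exact ⟨EReal.coe_ne_top _, EReal.coe_ne_bot _⟩
  · refine (hint (fun z => |W z - polyEval J z|)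
      (hWc.sub (continuous_polyEval J)).abs).congr_fun (fun z hz => ?_) hSm
    simp only
    rw [hVW z hz, EReal.toReal_coe]
  · obtain ⟨J, hJ⟩ := e.exists_isFeasible_one
    exact ⟨J, hJ.mono hd⟩
  · refine ⟨∫ z in S, w z * W z, ?_⟩
    rintro _ ⟨J, hJ, rfl⟩
    refine setIntegral_mono_on (hint _ (continuous_polyEval J)) (hint W hWc) hSm fun z hz => ?_
    exact mul_le_mul_of_nonneg_left (hJW d J hJ z hz) (hw0 z hz)
  · refine happrox (fun _ => 0) J tendsto_const_nhds (hJ.mono fun d hd => ?_)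
    exact ⟨hd.1, fun Q hQ => (hd.2 Q hQ).trans_eq (add_zero _).symm⟩
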